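/- Let $V,f_1,f_2,g_1,g_2\in W_2^1(0,\pi)$ be real-valued (continuous representatives), $m\in\mathbb R$, $\alpha,\beta\in(-\pi/2,\pi/2)$, $\omega(x)=\int_0^xV(t)\,dt$, and assume $\omega(\pi)=0$. Consider the Dirac problem $L$ on $(0,\pi)$ $$y_2'+(V+m)y_1=\lambda y_1,\qquad -y_1'+(V-m)y_2=\lambda y_2,$$ $$y_1(0)\sin\alpha+y_2(0)\cos\alpha=\int_0^\pi(f_1y_1+f_2y_2)\,dx,\qquad y_1(\pi)\sin\beta+y_2(\pi)\cos\beta=\int_0^\pi(g_1y_1+g_2y_2)\,dx.$$ Put $F_0=f_1(0)\sin\alpha+f_2(0)\cos\alpha$, $F_\pi=f_1(\pi)\sin\beta+f_2(\pi)\cos\beta$, $G_0=g_1(0)\sin\alpha+g_2(0)\cos\alpha$, $G_\pi=g_1(\pi)\sin\beta+g_2(\pi)\cos\beta$, $A_1=\frac{m^2\pi}{2}+m\cos(\alpha+\beta)\sin(\alpha-\beta)-(F_0+G_\pi)$ and $A_2=F_\pi+G_0$. A labelled nodal point $(n,j,x_n^j)$ of $L$ consists of integers $0\le j<n$ and the zero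 $x=x_n^j\in(0,\pi)$, having exactly $j$ zeros to its left in $(0,\pi)$, of the first component of a real eigenfunction of $L$ whose eigenvalue $\lambda$ satisfies $|\lambda-n|<1$ and whose first component has exactly $n$ zeros in $(0,\pi)$. A set $X$ of labelled nodal points is called dense if for every $N$ the points $x_n^j$ of $X$ with $n\ge N$ are dense in $(0,\pi)$. Let $X$ be a dense set of labelled nodal points of $L$. (a) For every $x\in[0,\pi]$ there are sequences $x_n^{j(n)}$ in $X$ with $n\to\infty$ and $x_n^{j(n)}\to x$, and along every such sequence $$n\Bigl(x_n^{j(n)}-\tfrac{(j(n)+1/2)\pi}{n}\Bigr)\to\psi_1(x)=\omega(x)+\tfrac{(\beta-\alpha)x}{\pi}+\alpha .$$ Moreover $\alpha=\psi_1(0)$, $\beta=\psi_1(\pi)$, and $\psi_1$ is differentiable with $V(x)=\psi_1'(x)+\frac{\alpha-\beta}{\pi}$ on $(0,\pi)$. (b) Suppose that the part of $X$ with even $n$ and the part with odd $n$ are both dense. Then for every $x\in[0,\pi]$, along every sequence in the even (respectively odd) part with $n\to\infty$ and $x_n^{j(n)}\to x$, and such sequences exist, $$n^2\pi\Bigl(x_n^{j(n)}-\tfrac{(j(n)+1/2)\pi+\omega(x_n^{j(n)})+\alpha}{n}+\tfrac{j(n)+1/2}{n}\cdot\tfrac{\alpha-\beta}{n}\Bigr)\to\psi_2^{+}(x)\quad(\text{respectively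 }\psi_2^-(x)),$$ $$\psi_2^{\pm}(x)=(\beta-\alpha)(\omega(x)+\alpha)+\tfrac{(\beta-\alpha)^2x}{\pi}-x(A_1\pm A_2)+\pi\Bigl(\tfrac{m^2x}{2}+\tfrac{m\sin2\alpha}{2}\pm F_\pi-F_0\Bigr),$$ and $$F_\pi=\frac{\psi_2^+(0)-\psi_2^-(0)}{2\pi},\qquad G_0=\frac{\psi_2^-(\pi)-\psi_2^+(\pi)}{2\pi},$$ $$F_0=-\frac{\psi_2^+(0)+\psi_2^-(0)}{2\pi}+\frac{\alpha(\beta-\alpha)}{\pi}+\frac{m\sin2\alpha}{2},\qquad G_\pi=\frac{\psi_2^-(\pi)+\psi_2^+(\pi)}{2\pi}-\frac{\beta(\beta-\alpha)}{\pi}-\frac{m\sin2\beta}{2}.$$ (c) Uniqueness: if $\tilde L$ is a second problem of the same kind (with its own $\tilde V,\tilde m,\tilde\alpha,\tilde\beta,\tilde f_i,\tilde g_i$, and with $\tilde\alpha,\tilde\beta\in(-\pi/2,\pi/2)$, $\tilde\omega(\pi)=0$) for which all elements of $X$ are labelled nodal points too, then $\tilde\alpha=\alpha$, $\tilde\beta=\beta$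 and $\tilde V=V$ on $[0,\pi]$. If in addition the even and the odd part of $X$ are both dense, then $\tilde F_\pi=F_\pi$ and $\tilde G_0=G_0$; and if also $\tilde m=m$, then $\tilde F_0=F_0$ and $\tilde G_\pi=G_\pi$. -/

import Mathlib

open Set Filter Topology MeasureTheory Real

noncomputable section

/-- `f` is (the continuous representative of) an element of `W_2^1(0,π)`: on `[0,π]` it is the
integral of a function that is square integrable on `(0,π)`. -/
def IsW12 (f : ℝ → ℝ) : Prop :=
  ∃ f' : ℝ → ℝ, MemLp f' 2 (volume.restrict (Ioo 0 π)) ∧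
    ∀ x ∈ Icc (0 : ℝ) π, f x = f 0 + ∫ t in (0 : ℝ)..x, f' t

/-- The data of the Dirac problem with integral type nonlocal boundary conditions:
the potential `V`, the mass `m`, the boundary angles, and the kernels of the two
nonlocal conditions. -/
structure DiracProblem where
  V : ℝ → ℝ
  m : ℝ
  α : ℝ
  β : ℝ
  f₁ : ℝ → ℝ
  f₂ : ℝ → ℝ
  g₁ : ℝ → ℝ
  g₂ : ℝ → ℝ
  hV : IsW12 V
  hf₁ : IsW12 f₁
  hf₂ : IsW12 f₂
  hg₁ : IsW12 g₁
  hg₂ : IsW12 g₂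

namespace DiracProblem

variable (P : DiracProblem)

/-- `ω(x) = ∫₀ˣ V`. -/
def ω (x : ℝ) : ℝ := ∫ t in (0 : ℝ)..x, P.V t

def F₀ : ℝ := P.f₁ 0 * sin P.α + P.f₂ 0 * cos P.α
def Fπ : ℝ := P.f₁ π * sin P.β + P.f₂ π * cos P.β
def G₀ : ℝ := P.g₁ 0 * sin P.α + P.g₂ 0 * cos P.α
def Gπ : ℝ := P.g₁ π * sin P.β + P.g₂ π * cos P.β

def A₁ : ℝ := P.m ^ 2 * π / 2 + P.m * cos (P.β + P.α) * sin (P.α - P.β) - (P.F₀ + P.Gπ)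
def A₂ : ℝ := P.Fπ + P.G₀

/-- `Y = (y₁, y₂)` is an eigenfunction for the real eigenvalue `lam`: a nontrivial solution on
`[0,π]` of `y₂' + (V + m) y₁ = lam y₁`, `-y₁' + (V - m) y₂ = lam y₂` that satisfies the two
nonlocal boundary conditions. -/
structure IsEigenfunction (lam : ℝ) (y₁ y₂ : ℝ → ℝ) : Prop where
  deriv₁ : ∀ x ∈ Icc (0 : ℝ) π,
    HasDerivWithinAt y₁ ((P.V x - P.m) * y₂ x - lam * y₂ x) (Icc 0 π) x
  deriv₂ : ∀ x ∈ Icc (0 : ℝ) π,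
    HasDerivWithinAt y₂ (lam * y₁ x - (P.V x + P.m) * y₁ x) (Icc 0 π) x
  bc_zero : y₁ 0 * sin P.α + y₂ 0 * cos P.α
    - ∫ x in (0 : ℝ)..π, (P.f₁ x * y₁ x + P.f₂ x * y₂ x) = 0
  bc_pi : y₁ π * sin P.β + y₂ π * cos P.β
    - ∫ x in (0 : ℝ)..π, (P.g₁ x * y₁ x + P.g₂ x * y₂ x) = 0
  nontrivial : ∃ x ∈ Icc (0 : ℝ) π, y₁ x ≠ 0 ∨ y₂ x ≠ 0

end DiracProblem

/-- The zeros of `y` in the open interval `(0,π)`. -/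
def zerosIn (y : ℝ → ℝ) : Set ℝ := {t | t ∈ Ioo (0 : ℝ) π ∧ y t = 0}

/-- The labelled nodal points `(n, j, x)`, `x = x_n^j`: the first component of an eigenfunction,
with eigenvalue `lam ∈ (n - 1, n + 1)`, has exactly `n` zeros in `(0,π)`, and `x` is the one that
has exactly `j` of them to its left (so `j = 0, …, n - 1`). -/
def DiracProblem.nodalPoints (P : DiracProblem) : Set (ℕ × ℕ × ℝ) :=
  {p | ∃ (lam : ℝ) (y₁ y₂ : ℝ → ℝ), P.IsEigenfunction lam y₁ y₂ ∧ |lam - p.1| < 1 ∧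
    (zerosIn y₁).encard = p.1 ∧ p.2.2 ∈ zerosIn y₁ ∧
    (zerosIn y₁ ∩ Iio p.2.2).encard = p.2.1}

/-- A set of labelled points is dense in `(0,π)` as `n → ∞`: for every `N` its points with
`n ≥ N` are dense in `(0,π)`. -/
def NodalDense (X : Set (ℕ × ℕ × ℝ)) : Prop :=
  ∀ N : ℕ, Ioo (0 : ℝ) π ⊆ closure {x | ∃ n j : ℕ, N ≤ n ∧ (n, j, x) ∈ X}

/-- The elements of `X` with even `n`. -/
def evenPart (X : Set (ℕ × ℕ × ℝ)) : Set (ℕ × ℕ × ℝ) := {p | p ∈ X ∧ Even p.1}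

/-- The elements of `X` with odd `n`. -/
def oddPart (X : Set (ℕ × ℕ × ℝ)) : Set (ℕ × ℕ × ℝ) := {p | p ∈ X ∧ Odd p.1}

/-- `s` is a sequence `x_{n}^{j(n)}` in `X` with `n → ∞` that converges to `x`. -/
def ApproachesIn (X : Set (ℕ × ℕ × ℝ)) (x : ℝ) (s : ℕ → ℕ × ℕ × ℝ) : Prop :=
  (∀ k, s k ∈ X) ∧ Tendsto (fun k => (s k).1) atTop atTop ∧
    Tendsto (fun k => (s k).2.2) atTop (𝓝 x)

/-- `ψ` is the limit function of the quantity `q` along `X`: every `x ∈ [0,π]` is approached by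
a sequence in `X`, and `q` tends to `ψ x` along every such sequence. -/
def IsLimitFunction (X : Set (ℕ × ℕ × ℝ)) (q : ℕ × ℕ × ℝ → ℝ) (ψ : ℝ → ℝ) : Prop :=
  ∀ x ∈ Icc (0 : ℝ) π, (∃ s, ApproachesIn X x s) ∧
    ∀ s, ApproachesIn X x s → Tendsto (fun k => q (s k)) atTop (𝓝 (ψ x))

/-- `n (x_n^j - (j + 1/2) π / n)`. -/
def nodalQ₁ (p : ℕ × ℕ × ℝ) : ℝ :=
  (p.1 : ℝ) * (p.2.2 - ((p.2.1 : ℝ) + 1 / 2) * π / p.1)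

/-- `n² π (x_n^j - ((j + 1/2) π + ω(x_n^j) + α) / n + ((j + 1/2) / n) ((α - β) / n))`. -/
def nodalQ₂ (ω : ℝ → ℝ) (α β : ℝ) (p : ℕ × ℕ × ℝ) : ℝ :=
  (p.1 : ℝ) ^ 2 * π *
    (p.2.2 - (((p.2.1 : ℝ) + 1 / 2) * π + (ω p.2.2 + α)) / p.1
      + (((p.2.1 : ℝ) + 1 / 2) / p.1) * ((α - β) / p.1))

end

/-! Write an eigenfunction in Prüfer form, `y₁ = u cos θ`, `y₂ = u sin θ`. Then `θ' = lam - V - m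
cos 2θ`, `u` is a multiple of `exp (-m ∫ sin 2θ)`, and the zeros of `y₁` are the points where `θ` is
an odd multiple of `π/2`. Integration gives the exact identity `θ x = θ 0 + lam x - ω x - m ∫₀ˣ cos
2θ` (`angle_eq`), from which all asymptotics are read off.

For large `lam` the angle increases and every integral against `cos 2θ`, `u cos θ` or `u sin θ` is
small, by a Riemann-Lebesgue lemma uniform over the family of angles. So the nonlocal terms vanish
in the limit and `θ 0 → -α`, while `θ π + β` approaches a multiple of `π`. Since `|α|, |β| < π/2`,
counting zeros shows that this multiple is `nπ` and that `θ = (j + 1/2)π` at the node. The identity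
at `π` gives `lam - n → (α - β)/π`; at the node it gives the first limit function.

For second order, everything is multiplied by `lam`. One integration by parts turns `lam` times a
nonlocal term into boundary values of the kernels plus small integrals; this produces `F₀, Fπ, G₀,
Gπ`, with the sign `σ = (-1)^n` attached to values from the opposite endpoint. Evaluation at `0` and
`π` for `σ = ±1` separates the four constants. Uniqueness follows because a limit function depends
only on `X` and on the quantity whose limit is taken. -/

noncomputable section

/-! ### Calculus on `[0,π]`. -/

lemma hasDerivWithinAt_integral_Icc {h : ℝ → ℝ} (hh : ContinuousOn h (Icc 0 π)) {x : ℝ}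
    (hx : x ∈ Icc 0 π) :
    HasDerivWithinAt (fun u => ∫ t in (0 : ℝ)..u, h t) (h x) (Icc 0 π) x := by
  have hπ : (0 : ℝ) ≤ π := pi_pos.le
  -- Nothing is known about `h` outside `[0,π]`; the constant extension is continuous on `ℝ`, so the
  -- two-sided fundamental theorem applies to it.
  set H : ℝ → ℝ := IccExtend hπ ((Icc 0 π).domRestrict h) with hH
  have hHc : Continuous H := hh.domRestrict.Icc_extend'
  have hEq : ∀ t ∈ Icc (0 : ℝ) π, H t = h t := fun t ht => by
    simp [hH, IccExtend_of_mem hπ _ ht]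
  have h1 : HasDerivWithinAt (fun u => ∫ t in (0 : ℝ)..u, H t) (H x) (Icc 0 π) x :=
    (intervalIntegral.integral_hasDerivAt_right (hHc.intervalIntegrable _ _)
      hHc.stronglyMeasurable.stronglyMeasurableAtFilter hHc.continuousAt).hasDerivWithinAt
  have key : ∀ u ∈ Icc (0 : ℝ) π, (∫ t in (0 : ℝ)..u, h t) = ∫ t in (0 : ℝ)..u, H t := by
    intro u hu
    refine intervalIntegral.integral_congr fun t ht => (hEq t ?_).symm
    rw [uIcc_of_le hu.1] at ht
    exact ⟨ht.1, ht.2.trans hu.2⟩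
  rw [← hEq x hx]
  exact h1.congr key (key x hx)

lemma ContinuousOn.intervalIntegrable_sub {h : ℝ → ℝ} (hh : ContinuousOn h (Icc 0 π)) {x : ℝ}
    (hx : x ∈ Icc 0 π) : IntervalIntegrable h volume 0 x :=
  (hh.mono (Icc_subset_Icc_right hx.2)).intervalIntegrable_of_Icc hx.1

lemma integral_eq_sub_of_hasDerivWithinAt_Icc {g g' : ℝ → ℝ}
    (hg : ∀ x ∈ Icc (0 : ℝ) π, HasDerivWithinAt g (g' x) (Icc 0 π) x)
    (hg' : ContinuousOn g' (Icc 0 π)) {x : ℝ} (hx : x ∈ Icc 0 π) :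
    ∫ t in (0 : ℝ)..x, g' t = g x - g 0 := by
  refine intervalIntegral.integral_eq_sub_of_hasDerivAt_of_le hx.1
    (fun t ht => ((hg t ⟨ht.1, ht.2.trans hx.2⟩).continuousWithinAt.mono
      (Icc_subset_Icc_right hx.2))) (fun t ht => ?_) (hg'.intervalIntegrable_sub hx)
  exact (hg t ⟨ht.1.le, ht.2.le.trans hx.2⟩).hasDerivAt
    (Icc_mem_nhds ht.1 (ht.2.trans_le hx.2))

lemma eq_left_of_hasDerivWithinAt_zero {g : ℝ → ℝ}
    (hg : ∀ x ∈ Icc (0 : ℝ) π, HasDerivWithinAt g 0 (Icc 0 π) x) {x : ℝ} (hx : x ∈ Icc 0 π) :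
    g x = g 0 := by
  have := integral_eq_sub_of_hasDerivWithinAt_Icc hg continuousOn_const hx
  simp at this
  linarith

lemma abs_integral_le_pi_mul {h : ℝ → ℝ} {M x : ℝ} (hx : x ∈ Icc 0 π)
    (hM : ∀ t ∈ Icc (0 : ℝ) π, |h t| ≤ M) : |∫ t in (0 : ℝ)..x, h t| ≤ π * M := by
  have h0 : 0 ≤ M := (abs_nonneg _).trans (hM x hx)
  have := intervalIntegral.norm_integral_le_of_norm_le_const (a := 0) (b := x) (f := h) (C := M)
    (fun t ht => by
      rw [uIoc_of_le hx.1] at ht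
      exact hM t ⟨ht.1.le, ht.2.trans hx.2⟩)
  rw [Real.norm_eq_abs, sub_zero, abs_of_nonneg hx.1] at this
  nlinarith [hx.2]

/-- Integration by parts against the primitive of an integrable function. -/
lemma integral_mul_deriv_of_primitive {f f' g g' : ℝ → ℝ}
    (hf' : IntervalIntegrable f' volume 0 π)
    (hf : ∀ x ∈ Icc (0 : ℝ) π, f x = f 0 + ∫ t in (0 : ℝ)..x, f' t)
    (hg : ∀ x ∈ Icc (0 : ℝ) π, HasDerivWithinAt g (g' x) (Icc 0 π) x)
    (hg' : ContinuousOn g' (Icc 0 π)) :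
    ∫ t in (0 : ℝ)..π, f t * g' t = f π * g π - f 0 * g 0 - ∫ t in (0 : ℝ)..π, f' t * g t := by
  have hπ : (0 : ℝ) ≤ π := pi_pos.le
  have hπm : π ∈ Icc (0 : ℝ) π := ⟨hπ, le_rfl⟩
  have h0m : (0 : ℝ) ∈ Icc (0 : ℝ) π := ⟨le_rfl, hπ⟩
  have hgi : IntervalIntegrable g' volume 0 π := hg'.intervalIntegrable_sub hπm
  -- The derivative of `f` exists only almost everywhere, so the product rule is used for absolutely
  -- continuous functions, with primitives defined on all of `ℝ`.
  set F : ℝ → ℝ := fun x => f 0 + ∫ t in (0 : ℝ)..x, f' t with hF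
  set G : ℝ → ℝ := fun x => g 0 + ∫ t in (0 : ℝ)..x, g' t with hG
  have hGg : ∀ x ∈ Icc (0 : ℝ) π, g x = G x := fun x hx => by
    simp only [hG, integral_eq_sub_of_hasDerivWithinAt_Icc hg hg' hx]; ring
  have hconst (c : ℝ) : AbsolutelyContinuousOnInterval (fun _ : ℝ => c) 0 π :=
    (contDiffOn_const (𝕜 := ℝ) (n := 1)).absolutelyContinuousOnInterval
  have hFa : AbsolutelyContinuousOnInterval F 0 π :=
    (hconst _).add (hf'.absolutelyContinuousOnInterval_intervalIntegral (by simp))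
  have hGa : AbsolutelyContinuousOnInterval G 0 π :=
    (hconst _).add (hgi.absolutelyContinuousOnInterval_intervalIntegral (by simp))
  have key := hFa.integral_mul_deriv_eq_deriv_mul hGa
  have e1 : ∫ t in (0 : ℝ)..π, F t * deriv G t = ∫ t in (0 : ℝ)..π, f t * g' t := by
    refine intervalIntegral.integral_congr_ae ?_
    filter_upwards [hgi.ae_hasDerivAt_integral] with x hx hx'
    have hx2 := uIoc_subset_uIcc hx'
    have hx3 : x ∈ Icc 0 π := by rwa [uIcc_of_le hπ] at hx2
    rw [((hx hx2 0 (by simp)).const_add (g 0)).deriv, hf x hx3]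
  have e2 : ∫ t in (0 : ℝ)..π, deriv F t * G t = ∫ t in (0 : ℝ)..π, f' t * g t := by
    refine intervalIntegral.integral_congr_ae ?_
    filter_upwards [hf'.ae_hasDerivAt_integral] with x hx hx'
    have hx2 := uIoc_subset_uIcc hx'
    have hx3 : x ∈ Icc 0 π := by rwa [uIcc_of_le hπ] at hx2
    rw [((hx hx2 0 (by simp)).const_add (f 0)).deriv, hGg x hx3]
  rw [e1, e2] at key
  rw [key, hGg π hπm, hGg 0 h0m, hf π hπm]
  simp [hF]

/-! ### Functions in `W_2^1` and the Riemann-Lebesgue lemma. -/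

lemma IsW12.exists_primitive {f : ℝ → ℝ} (hf : IsW12 f) :
    ∃ f' : ℝ → ℝ, IntervalIntegrable f' volume 0 π ∧
      ∀ x ∈ Icc (0 : ℝ) π, f x = f 0 + ∫ t in (0 : ℝ)..x, f' t := by
  obtain ⟨f', h1, h2⟩ := hf
  refine ⟨f', ?_, h2⟩
  rw [intervalIntegrable_iff_integrableOn_Ioo_of_le pi_pos.le]
  exact h1.integrable (by norm_num)

lemma IsW12.continuousOn {f : ℝ → ℝ} (hf : IsW12 f) : ContinuousOn f (Icc 0 π) := by
  obtain ⟨f', h1, h2⟩ := hf.exists_primitive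
  have := intervalIntegral.continuousOn_primitive_interval' h1 (by simp : (0 : ℝ) ∈ uIcc 0 π)
  rw [uIcc_of_le pi_pos.le] at this
  exact (continuousOn_const.add this).congr h2

lemma ContinuousOn.exists_abs_le {f : ℝ → ℝ} (hf : ContinuousOn f (Icc 0 π)) :
    ∃ M, 0 ≤ M ∧ ∀ x ∈ Icc (0 : ℝ) π, |f x| ≤ M := by
  obtain ⟨M, hM⟩ := isCompact_Icc.exists_bound_of_continuousOn hf
  exact ⟨M, (norm_nonneg _).trans (hM 0 ⟨le_rfl, pi_pos.le⟩), hM⟩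

/-- The Riemann-Lebesgue lemma for a bounded family whose primitives are `O(1 / lam)`. -/
lemma tendsto_integral_mul_of_primitive_bounded {ι : Type*} {l : Filter ι} {e : ι → ℝ → ℝ}
    {lam : ι → ℝ} {C K : ℝ} (hlam : Tendsto lam l atTop)
    (he : ∀ i, ContinuousOn (e i) (Icc 0 π))
    (hC : ∀ i, ∀ x ∈ Icc (0 : ℝ) π, |e i x| ≤ C)
    (hK : ∀ i, ∀ x ∈ Icc (0 : ℝ) π, |lam i * ∫ t in (0 : ℝ)..x, e i t| ≤ K)
    {h : ℝ → ℝ} (hh : IntervalIntegrable h volume 0 π) {x : ι → ℝ}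
    (hx : ∀ i, x i ∈ Icc (0 : ℝ) π) :
    Tendsto (fun i => ∫ t in (0 : ℝ)..x i, h t * e i t) l (𝓝 0) := by
  have hπ : (0 : ℝ) ≤ π := pi_pos.le
  rcases isEmpty_or_nonempty ι with hι | ⟨⟨i₀⟩⟩
  -- Without an index there is no bound from which `0 ≤ C` could be deduced; but then `l = ⊥`.
  · exact Subsingleton.elim (⊥ : Filter ι) l ▸ tendsto_bot
  have hC0 : 0 ≤ C := (abs_nonneg _).trans (hC i₀ 0 ⟨le_rfl, hπ⟩)
  rw [Metric.tendsto_nhds]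
  intro ε hε
  -- Two approximations, `h` by a continuous `g` in `L¹` and `g` uniformly by a polynomial, each
  -- cost at most `η * C` in the integral, together at most `ε / 2`.
  set η : ℝ := ε / (4 * (C + 1)) with hη
  have hηpos : 0 < η := by positivity
  rw [intervalIntegrable_iff_integrableOn_Icc_of_le hπ] at hh
  obtain ⟨g, -, hgh, hgc, -⟩ := Integrable.exists_hasCompactSupport_integral_sub_le
    (μ := volume.restrict (Icc (0 : ℝ) π)) hh hηpos
  obtain ⟨p, hp⟩ := exists_polynomial_near_of_continuousOn 0 π g hgc.continuousOn
    (η / π) (by positivity)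
  have hpc : Continuous fun t => p.eval t := p.continuous
  have hpc' : Continuous fun t => p.derivative.eval t := p.derivative.continuous
  obtain ⟨M, hM0, hM⟩ := (hpc.continuousOn (s := Icc 0 π)).exists_abs_le
  obtain ⟨M', hM0', hM'⟩ := (hpc'.continuousOn (s := Icc 0 π)).exists_abs_le
  -- The numerator bounds `lam i` times the polynomial integral after integration by parts; the `+
  -- 1` makes the later inequality strict and `lam i` positive.
  have hev : ∀ᶠ i in l, (M * K + π * (M' * K)) / (ε / 4) + 1 ≤ lam i :=
    hlam.eventually_ge_atTop _
  filter_upwards [hev] with i hi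
  have hK0 : 0 ≤ K := (abs_nonneg _).trans (hK i 0 ⟨le_rfl, hπ⟩)
  have hli : 0 < lam i := lt_of_lt_of_le (by positivity) hi
  set E : ℝ → ℝ := fun u => ∫ t in (0 : ℝ)..u, e i t with hE
  have hEd : ∀ u ∈ Icc (0 : ℝ) π, HasDerivWithinAt E (e i u) (Icc 0 π) u :=
    fun u hu => hasDerivWithinAt_integral_Icc (he i) hu
  have hEc : ContinuousOn E (Icc 0 π) := fun u hu => (hEd u hu).continuousWithinAt
  have hsub : Icc 0 (x i) ⊆ Icc 0 π := Icc_subset_Icc_right (hx i).2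
  have hint : ∀ {q : ℝ → ℝ}, IntegrableOn q (Icc 0 π) →
      IntervalIntegrable (fun t => q t * e i t) volume 0 (x i) := by
    intro q hq
    have : IntervalIntegrable q volume 0 (x i) := by
      rw [intervalIntegrable_iff_integrableOn_Icc_of_le (hx i).1]
      exact hq.mono_set hsub
    refine this.mul_continuousOn ?_
    rw [uIcc_of_le (hx i).1]
    exact (he i).mono hsub
  have hpi : IntegrableOn (fun t => p.eval t) (Icc 0 π) :=
    hpc.continuousOn.integrableOn_compact isCompact_Icc
  have hgi : IntegrableOn g (Icc 0 π) := hgc.continuousOn.integrableOn_compact isCompact_Icc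
  -- the polynomial part
  have hpoly : |∫ t in (0 : ℝ)..x i, p.eval t * e i t| < ε / 4 := by
    have hsum : (∫ t in (0 : ℝ)..x i, p.eval t * e i t)
        = p.eval (x i) * E (x i) - ∫ t in (0 : ℝ)..x i, p.derivative.eval t * E t := by
      have hd : ∀ u ∈ Icc (0 : ℝ) π, HasDerivWithinAt (fun u => p.eval u * E u)
          (p.derivative.eval u * E u + p.eval u * e i u) (Icc 0 π) u := fun u hu =>
        (p.hasDerivAt u).hasDerivWithinAt.mul (hEd u hu)
      have h1 : ContinuousOn (fun u => p.derivative.eval u * E u) (Icc 0 π) :=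
        hpc'.continuousOn.mul hEc
      have h2 : ContinuousOn (fun u => p.eval u * e i u) (Icc 0 π) :=
        hpc.continuousOn.mul (he i)
      have := integral_eq_sub_of_hasDerivWithinAt_Icc hd (h1.add h2) (hx i)
      rw [intervalIntegral.integral_add (h1.intervalIntegrable_sub (hx i))
        (h2.intervalIntegrable_sub (hx i))] at this
      have hE0 : E 0 = 0 := by simp [hE]
      rw [hE0] at this
      linarith
    have hb : |lam i * ∫ t in (0 : ℝ)..x i, p.eval t * e i t| ≤ M * K + π * (M' * K) := by
      have : lam i * (∫ t in (0 : ℝ)..x i, p.eval t * e i t)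
          = p.eval (x i) * (lam i * E (x i))
            - ∫ t in (0 : ℝ)..x i, p.derivative.eval t * (lam i * E t) := by
        have hcm : (∫ t in (0 : ℝ)..x i, p.derivative.eval t * (lam i * E t))
            = lam i * ∫ t in (0 : ℝ)..x i, p.derivative.eval t * E t := by
          rw [← intervalIntegral.integral_const_mul]
          exact intervalIntegral.integral_congr fun t _ => mul_left_comm _ _ _
        rw [hsum, hcm]
        ring
      rw [this]
      refine (abs_sub _ _).trans (add_le_add ?_ (abs_integral_le_pi_mul (hx i) fun t ht => ?_))
      · rw [abs_mul]
        exact mul_le_mul (hM _ (hx i)) (hK i _ (hx i)) (abs_nonneg _) hM0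
      · rw [abs_mul]
        exact mul_le_mul (hM' _ ht) (hK i _ ht) (abs_nonneg _) hM0'
    rw [abs_mul, abs_of_pos hli] at hb
    have h3 : (M * K + π * (M' * K)) < lam i * (ε / 4) := by
      rw [← div_lt_iff₀ (by positivity)]
      linarith
    exact lt_of_mul_lt_mul_left (hb.trans_lt h3) hli.le
  -- the remainder
  have hrem : |∫ t in (0 : ℝ)..x i, (h t - p.eval t) * e i t| ≤ ε / 2 := by
    have hd : IntegrableOn (fun t => |h t - g t| + η / π) (Icc 0 π) :=
      (hh.sub hgi).abs.add (integrableOn_const (by simp))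
    have h1 : |∫ t in (0 : ℝ)..x i, (h t - p.eval t) * e i t|
        ≤ ∫ t in (0 : ℝ)..x i, (|h t - g t| + η / π) * C := by
      rw [← Real.norm_eq_abs]
      refine intervalIntegral.norm_integral_le_of_norm_le (hx i).1 ?_ ?_
      · refine Eventually.of_forall fun t ht => ?_
        have ht' : t ∈ Icc 0 π := ⟨ht.1.le, ht.2.trans (hx i).2⟩
        rw [Real.norm_eq_abs, abs_mul]
        refine mul_le_mul ?_ (hC i t ht') (abs_nonneg _) (by positivity)
        have := hp t ht'
        rw [abs_sub_comm] at this
        linarith [abs_sub_le (h t) (g t) (p.eval t)]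
      · rw [intervalIntegrable_iff_integrableOn_Icc_of_le (hx i).1]
        exact (hd.mono_set hsub).mul_const C
    have h2 : ∫ t in (0 : ℝ)..x i, (|h t - g t| + η / π) * C
        ≤ ∫ t in (0 : ℝ)..π, (|h t - g t| + η / π) * C := by
      refine intervalIntegral.integral_mono_interval le_rfl (hx i).1 (hx i).2 ?_ ?_
      · exact Eventually.of_forall fun t => by simp only [Pi.zero_apply]; positivity
      · rw [intervalIntegrable_iff_integrableOn_Icc_of_le hπ]
        exact hd.mul_const C
    have h3 : ∫ t in (0 : ℝ)..π, (|h t - g t| + η / π) * C ≤ (η + η) * C := by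
      rw [intervalIntegral.integral_mul_const, intervalIntegral.integral_add]
      · refine mul_le_mul_of_nonneg_right (add_le_add ?_ ?_) hC0
        · rw [intervalIntegral.integral_of_le hπ, ← integral_Icc_eq_integral_Ioc]
          exact hgh
        · simp only [intervalIntegral.integral_const, sub_zero, smul_eq_mul]
          rw [mul_div_cancel₀ _ pi_pos.ne']
      · rw [intervalIntegrable_iff_integrableOn_Icc_of_le hπ]
        exact (hh.sub hgi).abs
      · exact intervalIntegrable_const
    have h4 : (η + η) * C ≤ ε / 2 := by
      have : η * (4 * (C + 1)) = ε := by rw [hη]; field_simp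
      nlinarith
    linarith
  have hsplit : (∫ t in (0 : ℝ)..x i, h t * e i t)
      = (∫ t in (0 : ℝ)..x i, p.eval t * e i t)
        + ∫ t in (0 : ℝ)..x i, (h t - p.eval t) * e i t := by
    have hr : IntervalIntegrable (fun t => (h t - p.eval t) * e i t) volume 0 (x i) :=
      hint (hh.sub hpi)
    rw [← intervalIntegral.integral_add (hint hpi) hr]
    exact intervalIntegral.integral_congr fun t _ => by ring
  rw [Real.dist_eq, sub_zero, hsplit]
  linarith [abs_add_le (∫ t in (0 : ℝ)..x i, p.eval t * e i t)
    (∫ t in (0 : ℝ)..x i, (h t - p.eval t) * e i t)]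

/-! ### The Prüfer transformation. -/

namespace DiracProblem

/-- The amplitude `exp (-m ∫₀ˣ sin 2θ)` that belongs to the Prüfer angle `θ`. -/
def amplitude (m : ℝ) (θ : ℝ → ℝ) (x : ℝ) : ℝ := exp (-m * ∫ t in (0 : ℝ)..x, sin (2 * θ t))

/-- `θ` is the Prüfer angle of an eigenfunction for the eigenvalue `lam`. -/
structure IsPruferAngle (P : DiracProblem) (lam : ℝ) (θ : ℝ → ℝ) : Prop where
  hasDeriv : ∀ x ∈ Icc (0 : ℝ) π,
    HasDerivWithinAt θ (lam - P.V x - P.m * cos (2 * θ x)) (Icc 0 π) x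
  bc_zero : sin (θ 0 + P.α) = ∫ x in (0 : ℝ)..π,
    (P.f₁ x * (amplitude P.m θ x * cos (θ x)) + P.f₂ x * (amplitude P.m θ x * sin (θ x)))
  bc_pi : amplitude P.m θ π * sin (θ π + P.β) = ∫ x in (0 : ℝ)..π,
    (P.g₁ x * (amplitude P.m θ x * cos (θ x)) + P.g₂ x * (amplitude P.m θ x * sin (θ x)))
  abs_le : |θ 0 + P.α| ≤ π / 2

variable {P : DiracProblem} {lam : ℝ} {y₁ y₂ : ℝ → ℝ}

lemma IsEigenfunction.hasDerivWithinAt_normSq (h : P.IsEigenfunction lam y₁ y₂) {x : ℝ}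
    (hx : x ∈ Icc 0 π) :
    HasDerivWithinAt (fun x => y₁ x ^ 2 + y₂ x ^ 2) (-4 * P.m * (y₁ x * y₂ x)) (Icc 0 π) x := by
  have h1 := (h.deriv₁ x hx).pow 2
  have h2 := (h.deriv₂ x hx).pow 2
  refine (h1.add h2).congr_deriv ?_
  push_cast
  ring

/-- The potential and `lam` cancel in the derivative of `R = y₁² + y₂²`, so `|R'| ≤ 2|m| R`. Hence
`R exp(2|m|t)` increases and `R exp(-2|m|t)` decreases, and a zero of `R` would spread over the
whole interval. -/
lemma IsEigenfunction.normSq_pos (h : P.IsEigenfunction lam y₁ y₂) {x : ℝ} (hx : x ∈ Icc 0 π) :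
    0 < y₁ x ^ 2 + y₂ x ^ 2 := by
  set R : ℝ → ℝ := fun x => y₁ x ^ 2 + y₂ x ^ 2 with hR
  have hRd : ∀ t ∈ Icc (0 : ℝ) π, HasDerivWithinAt R (-4 * P.m * (y₁ t * y₂ t)) (Icc 0 π) t :=
    fun t ht => h.hasDerivWithinAt_normSq ht
  have hR0 : ∀ t, 0 ≤ R t := fun t => by positivity
  have hbound : ∀ t, |-4 * P.m * (y₁ t * y₂ t)| ≤ 2 * |P.m| * R t := by
    intro t
    have : |y₁ t * y₂ t| ≤ R t / 2 := by
      rw [abs_le]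
      constructor <;> simp only [hR] <;> nlinarith [sq_nonneg (y₁ t + y₂ t), sq_nonneg (y₁ t - y₂ t)]
    rw [abs_mul, abs_mul, abs_neg, abs_of_pos (by norm_num : (0 : ℝ) < 4)]
    nlinarith [abs_nonneg P.m]
  have hE (c : ℝ) : ∀ t ∈ Icc (0 : ℝ) π, HasDerivWithinAt (fun t => R t * exp (c * t))
      ((-4 * P.m * (y₁ t * y₂ t) + c * R t) * exp (c * t)) (Icc 0 π) t := by
    intro t ht
    have h1 : HasDerivAt (fun t => exp (c * t)) (exp (c * t) * c) t := by
      simpa using ((hasDerivAt_id t).const_mul c).exp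
    refine ((hRd t ht).mul h1.hasDerivWithinAt).congr_deriv ?_
    ring
  have hmono : MonotoneOn (fun t => R t * exp (2 * |P.m| * t)) (Icc 0 π) := by
    refine monotoneOn_of_hasDerivWithinAt_nonneg (convex_Icc _ _)
      (fun t ht => (hE _ t ht).continuousWithinAt)
      (fun t ht => (hE _ t (interior_subset ht)).mono interior_subset) fun t _ => ?_
    have := (abs_le.1 (hbound t)).1
    exact mul_nonneg (by linarith) (exp_pos _).le
  have hanti : AntitoneOn (fun t => R t * exp (-(2 * |P.m|) * t)) (Icc 0 π) := by
    refine antitoneOn_of_hasDerivWithinAt_nonpos (convex_Icc _ _)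
      (fun t ht => (hE _ t ht).continuousWithinAt)
      (fun t ht => (hE _ t (interior_subset ht)).mono interior_subset) fun t _ => ?_
    have := (abs_le.1 (hbound t)).2
    exact mul_nonpos_of_nonpos_of_nonneg (by linarith) (exp_pos _).le
  refine lt_of_le_of_ne (hR0 x) fun h0 => ?_
  have h0 : R x = 0 := h0.symm
  obtain ⟨t, ht, hne⟩ := h.nontrivial
  have hRt : R t ≤ 0 := by
    rcases le_total t x with htx | htx
    · have := hmono ht hx htx
      simp only [h0, zero_mul] at this
      exact nonpos_of_mul_nonpos_left this (exp_pos _)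
    · have := hanti hx ht htx
      simp only [h0, zero_mul] at this
      exact nonpos_of_mul_nonpos_left this (exp_pos _)
  have h1 : y₁ t ^ 2 + y₂ t ^ 2 ≤ 0 := hRt
  have h2 : y₁ t = 0 := by nlinarith [sq_nonneg (y₁ t), sq_nonneg (y₂ t)]
  have h3 : y₂ t = 0 := by nlinarith [sq_nonneg (y₁ t), sq_nonneg (y₂ t)]
  exact hne.elim (· h2) (· h3)

/-- The function changes sign under a shift by `π`, so it vanishes somewhere in each closed interval
of length `π`. This picks the initial direction of the vector `(p, q)` up to sign. -/
lemma exists_angle_near (a p q : ℝ) : ∃ θ : ℝ, |θ + a| ≤ π / 2 ∧ -p * sin θ + q * cos θ = 0 := by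
  set k : ℝ → ℝ := fun θ => -p * sin θ + q * cos θ with hk
  have hkc : Continuous k := by fun_prop
  have hle : -a - π / 2 ≤ -a + π / 2 := by linarith [pi_pos]
  have hkk : k (-a + π / 2) = -k (-a - π / 2) := by
    simp only [hk, sin_add_pi_div_two, cos_add_pi_div_two, sin_sub_pi_div_two,
      cos_sub_pi_div_two]
    ring
  have : (0 : ℝ) ∈ k '' Icc (-a - π / 2) (-a + π / 2) := by
    rcases le_total 0 (k (-a - π / 2)) with hs | hs
    · exact intermediate_value_Icc' hle hkc.continuousOn ⟨by linarith, hs⟩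
    · exact intermediate_value_Icc hle hkc.continuousOn ⟨hs, by linarith⟩
  obtain ⟨θ, hθ, h0⟩ := this
  exact ⟨θ, abs_le.2 ⟨by linarith [hθ.1], by linarith [hθ.2]⟩, h0⟩

/-- The angle is built by integrating the angular velocity of `Y`, which avoids branches of the
arctangent. The components `u` along and `v` across `(cos θ, sin θ)` solve the same linear equation
`w' = ρ w`; as `v 0 = 0`, `v` vanishes identically and `Y = u (cos θ, sin θ)`. -/
theorem IsEigenfunction.exists_pruferAngle (h : P.IsEigenfunction lam y₁ y₂) :
    ∃ θ : ℝ → ℝ, P.IsPruferAngle lam θ ∧ ∀ x ∈ Icc (0 : ℝ) π, (y₁ x = 0 ↔ cos (θ x) = 0) := by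
  have h0m : (0 : ℝ) ∈ Icc (0 : ℝ) π := ⟨le_rfl, pi_pos.le⟩
  have hπm : π ∈ Icc (0 : ℝ) π := ⟨pi_pos.le, le_rfl⟩
  have hVc := P.hV.continuousOn
  have h1c : ContinuousOn y₁ (Icc 0 π) := fun x hx => (h.deriv₁ x hx).continuousWithinAt
  have h2c : ContinuousOn y₂ (Icc 0 π) := fun x hx => (h.deriv₂ x hx).continuousWithinAt
  set R : ℝ → ℝ := fun x => y₁ x ^ 2 + y₂ x ^ 2 with hR
  have hRpos : ∀ x ∈ Icc (0 : ℝ) π, 0 < R x := fun x hx => h.normSq_pos hx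
  have hRc : ContinuousOn R (Icc 0 π) := (h1c.pow 2).add (h2c.pow 2)
  obtain ⟨θ₀, hθ₀, hv0⟩ := exists_angle_near P.α (y₁ 0) (y₂ 0)
  -- `Φ` is the angular velocity `(y₁ y₂' - y₂ y₁') / R`, and `ρ` below is half the logarithmic
  -- derivative of `R`.
  set Φ : ℝ → ℝ := fun x => lam - P.V x - P.m * ((y₁ x ^ 2 - y₂ x ^ 2) / R x) with hΦ
  have hΦc : ContinuousOn Φ (Icc 0 π) :=
    (continuousOn_const.sub hVc).sub (continuousOn_const.mul
      (((h1c.pow 2).sub (h2c.pow 2)).div hRc fun x hx => (hRpos x hx).ne'))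
  set ρ : ℝ → ℝ := fun x => -2 * P.m * (y₁ x * y₂ x) / R x with hρ
  have hρc : ContinuousOn ρ (Icc 0 π) :=
    (continuousOn_const.mul (h1c.mul h2c)).div hRc fun x hx => (hRpos x hx).ne'
  set θ : ℝ → ℝ := fun x => θ₀ + ∫ t in (0 : ℝ)..x, Φ t with hθ
  have hθd : ∀ x ∈ Icc (0 : ℝ) π, HasDerivWithinAt θ (Φ x) (Icc 0 π) x := fun x hx =>
    (hasDerivWithinAt_integral_Icc hΦc hx).const_add θ₀
  have hθ0 : θ 0 = θ₀ := by simp [hθ]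
  set e : ℝ → ℝ := fun x => exp (-∫ t in (0 : ℝ)..x, ρ t) with he
  have hed : ∀ x ∈ Icc (0 : ℝ) π, HasDerivWithinAt e (e x * -ρ x) (Icc 0 π) x := fun x hx =>
    (hasDerivWithinAt_integral_Icc hρc hx).neg.exp
  have he0 : e 0 = 1 := by simp [he]
  set u : ℝ → ℝ := fun x => y₁ x * cos (θ x) + y₂ x * sin (θ x) with hu
  set v : ℝ → ℝ := fun x => -y₁ x * sin (θ x) + y₂ x * cos (θ x) with hv
  have hud : ∀ x ∈ Icc (0 : ℝ) π, HasDerivWithinAt (fun x => u x * e x) 0 (Icc 0 π) x := by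
    intro x hx
    refine ((((h.deriv₁ x hx).mul (hθd x hx).cos).add
      ((h.deriv₂ x hx).mul (hθd x hx).sin)).mul (hed x hx)).congr_deriv ?_
    have := (hRpos x hx).ne'
    simp only [hΦ, hρ]
    field_simp
    simp only [hR, Pi.add_apply, Pi.mul_apply]
    ring
  have hvd : ∀ x ∈ Icc (0 : ℝ) π, HasDerivWithinAt (fun x => v x * e x) 0 (Icc 0 π) x := by
    intro x hx
    refine ((((h.deriv₁ x hx).neg.mul (hθd x hx).sin).add
      ((h.deriv₂ x hx).mul (hθd x hx).cos)).mul (hed x hx)).congr_deriv ?_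
    have := (hRpos x hx).ne'
    simp only [hΦ, hρ]
    field_simp
    simp only [hR, Pi.add_apply, Pi.mul_apply, Pi.neg_apply]
    ring
  have hepos : ∀ x, 0 < e x := fun x => exp_pos _
  have hvz : ∀ x ∈ Icc (0 : ℝ) π, v x = 0 := by
    intro x hx
    have := eq_left_of_hasDerivWithinAt_zero hvd hx
    have h0 : v 0 = 0 := by simp only [hv, hθ0]; exact hv0
    rw [h0, zero_mul] at this
    exact (mul_eq_zero.1 this).resolve_right (hepos x).ne'
  have hy1 : ∀ x ∈ Icc (0 : ℝ) π, y₁ x = u x * cos (θ x) := by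
    intro x hx
    have h0 := hvz x hx
    simp only [hv] at h0
    simp only [hu]
    linear_combination (-y₁ x) * sin_sq_add_cos_sq (θ x) - sin (θ x) * h0
  have hy2 : ∀ x ∈ Icc (0 : ℝ) π, y₂ x = u x * sin (θ x) := by
    intro x hx
    have h0 := hvz x hx
    simp only [hv] at h0
    simp only [hu]
    linear_combination (-y₂ x) * sin_sq_add_cos_sq (θ x) + cos (θ x) * h0
  have hRu : ∀ x ∈ Icc (0 : ℝ) π, R x = u x ^ 2 := by
    intro x hx
    simp only [hR, hy1 x hx, hy2 x hx]
    linear_combination u x ^ 2 * sin_sq_add_cos_sq (θ x)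
  have hune : ∀ x ∈ Icc (0 : ℝ) π, u x ≠ 0 := by
    intro x hx h0
    have := hRpos x hx
    rw [hRu x hx, h0] at this
    simp at this
  have hcos : ∀ x ∈ Icc (0 : ℝ) π, (y₁ x ^ 2 - y₂ x ^ 2) / R x = cos (2 * θ x) := by
    intro x hx
    rw [hRu x hx, hy1 x hx, hy2 x hx, cos_two_mul']
    have := hune x hx
    field_simp
  have hsin : ∀ x ∈ Icc (0 : ℝ) π, ρ x = -P.m * sin (2 * θ x) := by
    intro x hx
    simp only [hρ]
    rw [hRu x hx, hy1 x hx, hy2 x hx, sin_two_mul]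
    have := hune x hx
    field_simp
  have hamp : ∀ x ∈ Icc (0 : ℝ) π, u x = u 0 * amplitude P.m θ x := by
    intro x hx
    have h1 := eq_left_of_hasDerivWithinAt_zero hud hx
    rw [he0, mul_one] at h1
    have h2 : amplitude P.m θ x = (e x)⁻¹ := by
      simp only [amplitude, he, exp_neg, inv_inv]
      rw [← intervalIntegral.integral_const_mul]
      congr 1
      refine intervalIntegral.integral_congr fun t ht => ?_
      rw [uIcc_of_le hx.1] at ht
      exact (hsin t ⟨ht.1, ht.2.trans hx.2⟩).symm
    rw [h2, ← h1, mul_assoc, mul_inv_cancel₀ (hepos x).ne', mul_one]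
  have hu0 := hune 0 h0m
  have hint : ∀ f₁ f₂ : ℝ → ℝ, ∫ x in (0 : ℝ)..π, (f₁ x * y₁ x + f₂ x * y₂ x)
      = u 0 * ∫ x in (0 : ℝ)..π,
        (f₁ x * (amplitude P.m θ x * cos (θ x)) + f₂ x * (amplitude P.m θ x * sin (θ x))) := by
    intro f₁ f₂
    rw [← intervalIntegral.integral_const_mul]
    refine intervalIntegral.integral_congr fun t ht => ?_
    rw [uIcc_of_le pi_pos.le] at ht
    rw [hy1 t ht, hy2 t ht, hamp t ht]
    ring
  refine ⟨θ, ⟨fun x hx => ?_, ?_, ?_, ?_⟩, fun x hx => ?_⟩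
  · rw [← hcos x hx]
    exact hθd x hx
  · have := h.bc_zero
    rw [hint, hy1 0 h0m, hy2 0 h0m] at this
    refine mul_left_cancel₀ hu0 ?_
    rw [sin_add]
    linarith
  · have := h.bc_pi
    rw [hint, hy1 π hπm, hy2 π hπm, hamp π hπm] at this
    refine mul_left_cancel₀ hu0 ?_
    rw [sin_add]
    linarith
  · rw [hθ0]
    exact hθ₀
  · rw [hy1 x hx, mul_eq_zero, or_iff_right (hune x hx)]

end DiracProblem

/-! ### Oscillatory integrals for a single Prüfer angle. -/

namespace DiracProblem

lemma abs_amplitude_le (m : ℝ) (θ : ℝ → ℝ) {x : ℝ} (hx : x ∈ Icc 0 π) :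
    |amplitude m θ x| ≤ exp (|m| * π) := by
  rw [amplitude, abs_of_pos (exp_pos _), exp_le_exp]
  refine (le_abs_self _).trans ?_
  rw [abs_mul, abs_neg]
  refine mul_le_mul_of_nonneg_left ?_ (abs_nonneg _)
  simpa using abs_integral_le_pi_mul hx (h := fun t => sin (2 * θ t)) (M := 1)
    fun t _ => abs_sin_le_one _

lemma amplitude_pos (m : ℝ) (θ : ℝ → ℝ) (x : ℝ) : 0 < amplitude m θ x := exp_pos _

lemma amplitude_zero (m : ℝ) (θ : ℝ → ℝ) : amplitude m θ 0 = 1 := by simp [amplitude]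

namespace IsPruferAngle

section Single

variable {P : DiracProblem} {lam : ℝ} {θ : ℝ → ℝ}

lemma continuousOn (h : P.IsPruferAngle lam θ) : ContinuousOn θ (Icc 0 π) :=
  fun x hx => (h.hasDeriv x hx).continuousWithinAt

lemma continuousOn_cos (h : P.IsPruferAngle lam θ) (k c : ℝ) :
    ContinuousOn (fun x => cos (k * θ x + c)) (Icc 0 π) :=
  continuous_cos.comp_continuousOn ((continuousOn_const.fun_mul h.continuousOn).add continuousOn_const)

lemma continuousOn_cos_two (h : P.IsPruferAngle lam θ) :
    ContinuousOn (fun x => cos (2 * θ x)) (Icc 0 π) := by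
  simpa using h.continuousOn_cos 2 0

lemma angle_eq (h : P.IsPruferAngle lam θ) {x : ℝ} (hx : x ∈ Icc 0 π) :
    θ x = θ 0 + lam * x - P.ω x - P.m * ∫ t in (0 : ℝ)..x, cos (2 * θ t) := by
  have hVc := P.hV.continuousOn
  have h2 := h.continuousOn_cos_two
  have := integral_eq_sub_of_hasDerivWithinAt_Icc h.hasDeriv
    ((continuousOn_const.fun_sub hVc).sub (continuousOn_const.fun_mul h2)) hx
  rw [intervalIntegral.integral_sub ((continuousOn_const.fun_sub hVc).intervalIntegrable_sub hx)
    ((continuousOn_const.fun_mul h2).intervalIntegrable_sub hx),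
    intervalIntegral.integral_sub (continuousOn_const.intervalIntegrable_sub hx)
    (hVc.intervalIntegrable_sub hx), intervalIntegral.integral_const_mul,
    intervalIntegral.integral_const] at this
  simp only [sub_zero, smul_eq_mul] at this
  rw [ω]
  linarith

/-- Integrate the derivative of `sin (kθ + c) / k`, in which `lam` multiplies the cosine and the
remaining factor is bounded. The phase `c` covers sines as well. -/
lemma lam_mul_integral_cos (h : P.IsPruferAngle lam θ) {k : ℝ} (hk : k ≠ 0) (c : ℝ) {x : ℝ}
    (hx : x ∈ Icc 0 π) :
    lam * ∫ t in (0 : ℝ)..x, cos (k * θ t + c)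
      = (sin (k * θ x + c) - sin (k * θ 0 + c)) / k
        + ∫ t in (0 : ℝ)..x, (P.V t + P.m * cos (2 * θ t)) * cos (k * θ t + c) := by
  have hVc := P.hV.continuousOn
  have h2 := h.continuousOn_cos_two
  have hkc := h.continuousOn_cos k c
  have hq : ContinuousOn (fun t => (P.V t + P.m * cos (2 * θ t)) * cos (k * θ t + c)) (Icc 0 π) :=
    (hVc.fun_add (continuousOn_const.fun_mul h2)).mul hkc
  have hd : ∀ x ∈ Icc (0 : ℝ) π, HasDerivWithinAt (fun x => sin (k * θ x + c) / k)
      (lam * cos (k * θ x + c) - (P.V x + P.m * cos (2 * θ x)) * cos (k * θ x + c))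
      (Icc 0 π) x := by
    intro x hx
    refine (((((h.hasDeriv x hx).const_mul k).add_const c).sin).div_const k).congr_deriv ?_
    field_simp
    ring
  have hlc : ContinuousOn (fun x => lam * cos (k * θ x + c)) (Icc 0 π) :=
    continuousOn_const.fun_mul hkc
  have := integral_eq_sub_of_hasDerivWithinAt_Icc hd (hlc.sub hq) hx
  rw [intervalIntegral.integral_sub (hlc.intervalIntegrable_sub hx)
    (hq.intervalIntegrable_sub hx), intervalIntegral.integral_const_mul] at this
  rw [sub_div]
  linarith

/-- The bound does not depend on `lam` or `θ`, as the uniform Riemann-Lebesgue lemma requires. -/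
lemma abs_lam_mul_integral_cos_le (h : P.IsPruferAngle lam θ) {M : ℝ}
    (hM : ∀ x ∈ Icc (0 : ℝ) π, |P.V x| ≤ M) {k : ℝ} (hk : 1 ≤ k) (c : ℝ) {x : ℝ}
    (hx : x ∈ Icc 0 π) :
    |lam * ∫ t in (0 : ℝ)..x, cos (k * θ t + c)| ≤ 2 + π * (M + |P.m|) := by
  rw [h.lam_mul_integral_cos (by linarith) c hx]
  refine (abs_add_le _ _).trans (add_le_add ?_ (abs_integral_le_pi_mul hx fun t ht => ?_))
  · rw [abs_div, abs_of_pos (by linarith : 0 < k), div_le_iff₀ (by linarith)]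
    have := abs_sub (sin (k * θ x + c)) (sin (k * θ 0 + c))
    linarith [abs_sin_le_one (k * θ x + c), abs_sin_le_one (k * θ 0 + c)]
  · rw [abs_mul]
    have h1 : |P.V t + P.m * cos (2 * θ t)| ≤ M + |P.m| := by
      refine (abs_add_le _ _).trans (add_le_add (hM t ht) ?_)
      rw [abs_mul]
      exact mul_le_of_le_one_right (abs_nonneg _) (abs_cos_le_one _)
    exact (mul_le_of_le_one_right (abs_nonneg _) (abs_cos_le_one _)).trans h1

lemma hasDerivWithinAt_amplitude (h : P.IsPruferAngle lam θ) {x : ℝ} (hx : x ∈ Icc 0 π) :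
    HasDerivWithinAt (amplitude P.m θ) (amplitude P.m θ x * (-P.m * sin (2 * θ x)))
      (Icc 0 π) x :=
  ((hasDerivWithinAt_integral_Icc (continuous_sin.comp_continuousOn
    (continuousOn_const.fun_mul h.continuousOn)) hx).const_mul (-P.m)).exp

lemma hasDerivWithinAt_cos (h : P.IsPruferAngle lam θ) {x : ℝ} (hx : x ∈ Icc 0 π) :
    HasDerivWithinAt (fun x => amplitude P.m θ x * cos (θ x))
      ((P.V x - P.m) * (amplitude P.m θ x * sin (θ x)) - lam * (amplitude P.m θ x * sin (θ x)))
      (Icc 0 π) x := by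
  refine ((h.hasDerivWithinAt_amplitude hx).mul (h.hasDeriv x hx).cos).congr_deriv ?_
  rw [sin_two_mul, cos_two_mul]
  ring

lemma hasDerivWithinAt_sin (h : P.IsPruferAngle lam θ) {x : ℝ} (hx : x ∈ Icc 0 π) :
    HasDerivWithinAt (fun x => amplitude P.m θ x * sin (θ x))
      (lam * (amplitude P.m θ x * cos (θ x)) - (P.V x + P.m) * (amplitude P.m θ x * cos (θ x)))
      (Icc 0 π) x := by
  refine ((h.hasDerivWithinAt_amplitude hx).mul (h.hasDeriv x hx).sin).congr_deriv ?_
  rw [sin_two_mul, cos_two_mul']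
  linear_combination -P.m * amplitude P.m θ x * cos (θ x) * sin_sq_add_cos_sq (θ x)

lemma continuousOn_amplitude_cos (h : P.IsPruferAngle lam θ) :
    ContinuousOn (fun x => amplitude P.m θ x * cos (θ x)) (Icc 0 π) :=
  fun _ hx => (h.hasDerivWithinAt_cos hx).continuousWithinAt

lemma continuousOn_amplitude_sin (h : P.IsPruferAngle lam θ) :
    ContinuousOn (fun x => amplitude P.m θ x * sin (θ x)) (Icc 0 π) :=
  fun _ hx => (h.hasDerivWithinAt_sin hx).continuousWithinAt

/-- By the Dirac system, `lam` times one component is the derivative of the other plus a term free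
of `lam`. Integration by parts moves that derivative onto `f`, leaving boundary values and integrals
without the factor `lam`. -/
lemma lam_mul_integral_amplitude_cos (h : P.IsPruferAngle lam θ) {f f' : ℝ → ℝ}
    (hf' : IntervalIntegrable f' volume 0 π)
    (hf : ∀ x ∈ Icc (0 : ℝ) π, f x = f 0 + ∫ t in (0 : ℝ)..x, f' t)
    (hfc : ContinuousOn f (Icc 0 π)) :
    lam * ∫ t in (0 : ℝ)..π, f t * (amplitude P.m θ t * cos (θ t))
      = f π * (amplitude P.m θ π * sin (θ π)) - f 0 * sin (θ 0)
        - (∫ t in (0 : ℝ)..π, f' t * (amplitude P.m θ t * sin (θ t)))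
        + ∫ t in (0 : ℝ)..π, (f t * (P.V t + P.m)) * (amplitude P.m θ t * cos (θ t)) := by
  have hπm : π ∈ Icc (0 : ℝ) π := ⟨pi_pos.le, le_rfl⟩
  have hVc := P.hV.continuousOn
  have hc := h.continuousOn_amplitude_cos
  have hl : ContinuousOn (fun t => lam * (f t * (amplitude P.m θ t * cos (θ t)))) (Icc 0 π) :=
    continuousOn_const.fun_mul (hfc.fun_mul hc)
  have hr : ContinuousOn
      (fun t => (f t * (P.V t + P.m)) * (amplitude P.m θ t * cos (θ t))) (Icc 0 π) :=
    (hfc.fun_mul (hVc.fun_add continuousOn_const)).fun_mul hc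
  have key := integral_mul_deriv_of_primitive hf' hf (fun x hx => h.hasDerivWithinAt_sin hx)
    ((continuousOn_const.fun_mul hc).sub ((hVc.fun_add continuousOn_const).fun_mul hc))
  have e : (∫ t in (0 : ℝ)..π, f t * (lam * (amplitude P.m θ t * cos (θ t))
        - (P.V t + P.m) * (amplitude P.m θ t * cos (θ t))))
      = (∫ t in (0 : ℝ)..π, lam * (f t * (amplitude P.m θ t * cos (θ t))))
        - ∫ t in (0 : ℝ)..π, (f t * (P.V t + P.m)) * (amplitude P.m θ t * cos (θ t)) := by
    rw [← intervalIntegral.integral_sub (hl.intervalIntegrable_sub hπm)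
      (hr.intervalIntegrable_sub hπm)]
    exact intervalIntegral.integral_congr fun t _ => by ring
  rw [e, intervalIntegral.integral_const_mul, amplitude_zero] at key
  linarith

lemma lam_mul_integral_amplitude_sin (h : P.IsPruferAngle lam θ) {f f' : ℝ → ℝ}
    (hf' : IntervalIntegrable f' volume 0 π)
    (hf : ∀ x ∈ Icc (0 : ℝ) π, f x = f 0 + ∫ t in (0 : ℝ)..x, f' t)
    (hfc : ContinuousOn f (Icc 0 π)) :
    lam * ∫ t in (0 : ℝ)..π, f t * (amplitude P.m θ t * sin (θ t))
      = -(f π * (amplitude P.m θ π * cos (θ π)) - f 0 * cos (θ 0))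
        + (∫ t in (0 : ℝ)..π, f' t * (amplitude P.m θ t * cos (θ t)))
        + ∫ t in (0 : ℝ)..π, (f t * (P.V t - P.m)) * (amplitude P.m θ t * sin (θ t)) := by
  have hπm : π ∈ Icc (0 : ℝ) π := ⟨pi_pos.le, le_rfl⟩
  have hVc := P.hV.continuousOn
  have hc := h.continuousOn_amplitude_sin
  have hl : ContinuousOn (fun t => lam * (f t * (amplitude P.m θ t * sin (θ t)))) (Icc 0 π) :=
    continuousOn_const.fun_mul (hfc.fun_mul hc)
  have hr : ContinuousOn
      (fun t => (f t * (P.V t - P.m)) * (amplitude P.m θ t * sin (θ t))) (Icc 0 π) :=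
    (hfc.fun_mul (hVc.fun_sub continuousOn_const)).fun_mul hc
  have key := integral_mul_deriv_of_primitive hf' hf (fun x hx => h.hasDerivWithinAt_cos hx)
    (((hVc.fun_sub continuousOn_const).fun_mul hc).sub (continuousOn_const.fun_mul hc))
  have e : (∫ t in (0 : ℝ)..π, f t * ((P.V t - P.m) * (amplitude P.m θ t * sin (θ t))
        - lam * (amplitude P.m θ t * sin (θ t))))
      = (∫ t in (0 : ℝ)..π, (f t * (P.V t - P.m)) * (amplitude P.m θ t * sin (θ t)))
        - ∫ t in (0 : ℝ)..π, lam * (f t * (amplitude P.m θ t * sin (θ t))) := by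
    rw [← intervalIntegral.integral_sub (hr.intervalIntegrable_sub hπm)
      (hl.intervalIntegrable_sub hπm)]
    exact intervalIntegral.integral_congr fun t _ => by ring
  rw [e, intervalIntegral.integral_const_mul, amplitude_zero] at key
  linarith

lemma abs_amplitude_cos_le (m : ℝ) (θ : ℝ → ℝ) {x : ℝ} (hx : x ∈ Icc 0 π) :
    |amplitude m θ x * cos (θ x)| ≤ exp (|m| * π) := by
  rw [abs_mul]
  exact (mul_le_of_le_one_right (abs_nonneg _) (abs_cos_le_one _)).trans (abs_amplitude_le m θ hx)

lemma abs_amplitude_sin_le (m : ℝ) (θ : ℝ → ℝ) {x : ℝ} (hx : x ∈ Icc 0 π) :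
    |amplitude m θ x * sin (θ x)| ≤ exp (|m| * π) := by
  rw [abs_mul]
  exact (mul_le_of_le_one_right (abs_nonneg _) (abs_sin_le_one _)).trans (abs_amplitude_le m θ hx)

lemma abs_lam_mul_integral_amplitude_cos_le (h : P.IsPruferAngle lam θ) {M : ℝ}
    (hM : ∀ x ∈ Icc (0 : ℝ) π, |P.V x| ≤ M) {x : ℝ} (hx : x ∈ Icc 0 π) :
    |lam * ∫ t in (0 : ℝ)..x, amplitude P.m θ t * cos (θ t)|
      ≤ 2 * exp (|P.m| * π) + π * ((M + |P.m|) * exp (|P.m| * π)) := by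
  have hVc := P.hV.continuousOn
  have hc := h.continuousOn_amplitude_cos
  have hr := (hVc.fun_add (continuousOn_const (c := P.m))).fun_mul hc
  have hl := (continuousOn_const (c := lam)).fun_mul hc
  have key := integral_eq_sub_of_hasDerivWithinAt_Icc (fun x hx => h.hasDerivWithinAt_sin hx)
    (hl.fun_sub hr) hx
  rw [intervalIntegral.integral_sub (hl.intervalIntegrable_sub hx) (hr.intervalIntegrable_sub hx),
    intervalIntegral.integral_const_mul, sub_eq_iff_eq_add] at key
  rw [key]
  refine (abs_add_le _ _).trans (add_le_add ?_ (abs_integral_le_pi_mul hx fun t ht => ?_))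
  · refine (abs_sub _ _).trans ?_
    linarith [abs_amplitude_sin_le P.m θ hx,
      abs_amplitude_sin_le P.m θ (⟨le_rfl, pi_pos.le⟩ : (0 : ℝ) ∈ Icc 0 π)]
  · rw [abs_mul]
    have hMt := hM t ht
    exact mul_le_mul ((abs_add_le _ _).trans (by gcongr)) (abs_amplitude_cos_le P.m θ ht)
      (abs_nonneg _) (by linarith [abs_nonneg (P.V t), abs_nonneg P.m])

lemma abs_lam_mul_integral_amplitude_sin_le (h : P.IsPruferAngle lam θ) {M : ℝ}
    (hM : ∀ x ∈ Icc (0 : ℝ) π, |P.V x| ≤ M) {x : ℝ} (hx : x ∈ Icc 0 π) :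
    |lam * ∫ t in (0 : ℝ)..x, amplitude P.m θ t * sin (θ t)|
      ≤ 2 * exp (|P.m| * π) + π * ((M + |P.m|) * exp (|P.m| * π)) := by
  have hVc := P.hV.continuousOn
  have hc := h.continuousOn_amplitude_sin
  have hr := (hVc.fun_sub (continuousOn_const (c := P.m))).fun_mul hc
  have hl := (continuousOn_const (c := lam)).fun_mul hc
  have key := integral_eq_sub_of_hasDerivWithinAt_Icc (fun x hx => h.hasDerivWithinAt_cos hx)
    (hr.fun_sub hl) hx
  rw [intervalIntegral.integral_sub (hr.intervalIntegrable_sub hx) (hl.intervalIntegrable_sub hx),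
    intervalIntegral.integral_const_mul, sub_eq_iff_eq_add, ← sub_eq_iff_eq_add',
    eq_comm] at key
  rw [key]
  refine (abs_sub _ _).trans ?_
  rw [add_comm]
  refine add_le_add ?_ (abs_integral_le_pi_mul hx fun t ht => ?_)
  · refine (abs_sub _ _).trans ?_
    linarith [abs_amplitude_cos_le P.m θ hx,
      abs_amplitude_cos_le P.m θ (⟨le_rfl, pi_pos.le⟩ : (0 : ℝ) ∈ Icc 0 π)]
  · rw [abs_mul]
    have hMt := hM t ht
    exact mul_le_mul ((abs_sub _ _).trans (by gcongr)) (abs_amplitude_sin_le P.m θ ht)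
      (abs_nonneg _) (by linarith [abs_nonneg (P.V t), abs_nonneg P.m])

end Single

/-! ### Limits along a family with `lam → ∞`. -/

section Family

variable {P : DiracProblem} {ι : Type*} {l : Filter ι} {lam : ι → ℝ} {θ : ι → ℝ → ℝ}

lemma tendsto_integral_mul_cos (h : ∀ i, P.IsPruferAngle (lam i) (θ i))
    (hlam : Tendsto lam l atTop) {f : ℝ → ℝ} (hf : IntervalIntegrable f volume 0 π) {k : ℝ}
    (hk : 1 ≤ k) (c : ℝ) {x : ι → ℝ} (hx : ∀ i, x i ∈ Icc (0 : ℝ) π) :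
    Tendsto (fun i => ∫ t in (0 : ℝ)..x i, f t * cos (k * θ i t + c)) l (𝓝 0) := by
  obtain ⟨M, -, hM⟩ := P.hV.continuousOn.exists_abs_le
  exact tendsto_integral_mul_of_primitive_bounded hlam (fun i => (h i).continuousOn_cos k c)
    (fun i x _ => abs_cos_le_one _) (fun i x hx => (h i).abs_lam_mul_integral_cos_le hM hk c hx)
    hf hx

lemma tendsto_integral_mul_amplitude_cos (h : ∀ i, P.IsPruferAngle (lam i) (θ i))
    (hlam : Tendsto lam l atTop) {f : ℝ → ℝ} (hf : IntervalIntegrable f volume 0 π) :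
    Tendsto (fun i => ∫ t in (0 : ℝ)..π, f t * (amplitude P.m (θ i) t * cos (θ i t))) l
      (𝓝 0) := by
  obtain ⟨M, -, hM⟩ := P.hV.continuousOn.exists_abs_le
  exact tendsto_integral_mul_of_primitive_bounded hlam
    (fun i => (h i).continuousOn_amplitude_cos) (fun i x hx => abs_amplitude_cos_le _ _ hx)
    (fun i x hx => (h i).abs_lam_mul_integral_amplitude_cos_le hM hx) hf
    (fun _ => ⟨pi_pos.le, le_rfl⟩)

lemma tendsto_integral_mul_amplitude_sin (h : ∀ i, P.IsPruferAngle (lam i) (θ i))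
    (hlam : Tendsto lam l atTop) {f : ℝ → ℝ} (hf : IntervalIntegrable f volume 0 π) :
    Tendsto (fun i => ∫ t in (0 : ℝ)..π, f t * (amplitude P.m (θ i) t * sin (θ i t))) l
      (𝓝 0) := by
  obtain ⟨M, -, hM⟩ := P.hV.continuousOn.exists_abs_le
  exact tendsto_integral_mul_of_primitive_bounded hlam
    (fun i => (h i).continuousOn_amplitude_sin) (fun i x hx => abs_amplitude_sin_le _ _ hx)
    (fun i x hx => (h i).abs_lam_mul_integral_amplitude_sin_le hM hx) hf
    (fun _ => ⟨pi_pos.le, le_rfl⟩)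

lemma tendsto_integral_cos_two (h : ∀ i, P.IsPruferAngle (lam i) (θ i))
    (hlam : Tendsto lam l atTop) {x : ι → ℝ} (hx : ∀ i, x i ∈ Icc (0 : ℝ) π) :
    Tendsto (fun i => ∫ t in (0 : ℝ)..x i, cos (2 * θ i t)) l (𝓝 0) := by
  simpa using tendsto_integral_mul_cos h hlam (f := fun _ => 1) (by simp) one_le_two 0 hx

lemma tendsto_amplitude_pi (h : ∀ i, P.IsPruferAngle (lam i) (θ i))
    (hlam : Tendsto lam l atTop) :
    Tendsto (fun i => amplitude P.m (θ i) π) l (𝓝 1) := by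
  -- The phase `-π/2` turns the cosine into `sin 2θ`, the integrand in the exponent of the
  -- amplitude.
  have := tendsto_integral_mul_cos h hlam (f := fun _ => 1) (by simp) one_le_two (-(π / 2))
    (x := fun _ => π) (fun _ => ⟨pi_pos.le, le_rfl⟩)
  simp only [one_mul, ← sub_eq_add_neg, cos_sub_pi_div_two] at this
  simpa [amplitude] using ((this.const_mul (-P.m)).rexp)

/-- The second order asymptotics of `∫₀ˣ cos 2θ`. -/
lemma tendsto_lam_mul_integral_cos_two (h : ∀ i, P.IsPruferAngle (lam i) (θ i))
    (hlam : Tendsto lam l atTop) {x : ι → ℝ} {x₀ a b : ℝ} (hx : ∀ i, x i ∈ Icc (0 : ℝ) π)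
    (hx₀ : Tendsto x l (𝓝 x₀)) (ha : Tendsto (fun i => sin (2 * θ i (x i))) l (𝓝 a))
    (hb : Tendsto (fun i => sin (2 * θ i 0)) l (𝓝 b)) :
    Tendsto (fun i => lam i * ∫ t in (0 : ℝ)..x i, cos (2 * θ i t)) l
      (𝓝 ((a - b) / 2 + P.m * x₀ / 2)) := by
  have hVc := P.hV.continuousOn
  have hV := tendsto_integral_mul_cos h hlam (hVc.intervalIntegrable_sub ⟨pi_pos.le, le_rfl⟩)
    one_le_two 0 hx
  have h4 := tendsto_integral_mul_cos h hlam (f := fun _ => 1) (by simp)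
    (by norm_num : (1 : ℝ) ≤ 4) 0 hx
  simp only [add_zero, one_mul] at hV h4
  have key : ∀ i, lam i * ∫ t in (0 : ℝ)..x i, cos (2 * θ i t)
      = (sin (2 * θ i (x i)) - sin (2 * θ i 0)) / 2
        + (∫ t in (0 : ℝ)..x i, P.V t * cos (2 * θ i t))
        + P.m * (x i / 2 + (∫ t in (0 : ℝ)..x i, cos (4 * θ i t)) / 2) := by
    intro i
    have h1 := (h i).lam_mul_integral_cos two_ne_zero 0 (hx i)
    simp only [add_zero] at h1
    have c2 := (h i).continuousOn_cos_two
    have c4 : ContinuousOn (fun t => cos (4 * θ i t)) (Icc 0 π) := by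
      simpa using (h i).continuousOn_cos 4 0
    have cV := (hVc.fun_mul c2).intervalIntegrable_sub (hx i)
    have c5 : ContinuousOn (fun t => 1 / 2 + 1 / 2 * cos (4 * θ i t)) (Icc 0 π) :=
      continuousOn_const.fun_add (continuousOn_const.fun_mul c4)
    have e : (∫ t in (0 : ℝ)..x i, (P.V t + P.m * cos (2 * θ i t)) * cos (2 * θ i t))
        = (∫ t in (0 : ℝ)..x i, P.V t * cos (2 * θ i t))
          + P.m * ∫ t in (0 : ℝ)..x i, (1 / 2 + 1 / 2 * cos (4 * θ i t)) := by
      rw [← intervalIntegral.integral_const_mul, ← intervalIntegral.integral_add cV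
        ((c5.intervalIntegrable_sub (hx i)).const_mul _)]
      refine intervalIntegral.integral_congr fun t _ => ?_
      -- `cos² 2θ` has mean `1/2`, which is the source of the term `P.m * x₀ / 2`.
      have : cos (4 * θ i t) = 2 * cos (2 * θ i t) ^ 2 - 1 := by
        rw [← cos_two_mul]
        ring_nf
      simp only [this]
      ring
    rw [h1, e, intervalIntegral.integral_add (continuousOn_const.intervalIntegrable_sub (hx i))
      ((continuousOn_const.fun_mul c4).intervalIntegrable_sub (hx i)),
      intervalIntegral.integral_const_mul, intervalIntegral.integral_const, smul_eq_mul]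
    ring
  simp only [key]
  convert (((ha.sub hb).div_const 2).add hV).add
    (((hx₀.div_const 2).add (h4.div_const 2)).const_mul P.m) using 2
  ring

/-- The asymptotics of the nonlocal terms in the boundary conditions. -/
lemma tendsto_lam_mul_nonlocal_sub (h : ∀ i, P.IsPruferAngle (lam i) (θ i))
    (hlam : Tendsto lam l atTop) {f₁ f₂ : ℝ → ℝ} (hf₁ : IsW12 f₁) (hf₂ : IsW12 f₂) :
    Tendsto (fun i => lam i * (∫ x in (0 : ℝ)..π, (f₁ x * (amplitude P.m (θ i) x * cos (θ i x))
        + f₂ x * (amplitude P.m (θ i) x * sin (θ i x))))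
      - (amplitude P.m (θ i) π * (f₁ π * sin (θ i π) - f₂ π * cos (θ i π))
        - (f₁ 0 * sin (θ i 0) - f₂ 0 * cos (θ i 0)))) l (𝓝 0) := by
  have hπm : π ∈ Icc (0 : ℝ) π := ⟨pi_pos.le, le_rfl⟩
  have hVc := P.hV.continuousOn
  have c1 := hf₁.continuousOn
  have c2 := hf₂.continuousOn
  obtain ⟨f₁', i1, p1⟩ := hf₁.exists_primitive
  obtain ⟨f₂', i2, p2⟩ := hf₂.exists_primitive
  have t1 := tendsto_integral_mul_amplitude_sin h hlam i1
  have t2 := tendsto_integral_mul_amplitude_cos h hlam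
    ((c1.fun_mul (hVc.fun_add (continuousOn_const (c := P.m)))).intervalIntegrable_sub hπm)
  have t3 := tendsto_integral_mul_amplitude_cos h hlam i2
  have t4 := tendsto_integral_mul_amplitude_sin h hlam
    ((c2.fun_mul (hVc.fun_sub (continuousOn_const (c := P.m)))).intervalIntegrable_sub hπm)
  convert ((t2.sub t1).add (t3.add t4)) using 2 with i
  · rw [intervalIntegral.integral_add
      ((c1.fun_mul (h i).continuousOn_amplitude_cos).intervalIntegrable_sub hπm)
      ((c2.fun_mul (h i).continuousOn_amplitude_sin).intervalIntegrable_sub hπm), mul_add,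
      (h i).lam_mul_integral_amplitude_cos i1 p1 c1,
      (h i).lam_mul_integral_amplitude_sin i2 p2 c2]
    ring
  · ring

lemma tendsto_nonlocal (h : ∀ i, P.IsPruferAngle (lam i) (θ i))
    (hlam : Tendsto lam l atTop) {f₁ f₂ : ℝ → ℝ} (hf₁ : IsW12 f₁) (hf₂ : IsW12 f₂) :
    Tendsto (fun i => ∫ x in (0 : ℝ)..π, (f₁ x * (amplitude P.m (θ i) x * cos (θ i x))
        + f₂ x * (amplitude P.m (θ i) x * sin (θ i x)))) l (𝓝 0) := by
  have hπm : π ∈ Icc (0 : ℝ) π := ⟨pi_pos.le, le_rfl⟩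
  have c1 := hf₁.continuousOn
  have c2 := hf₂.continuousOn
  convert (tendsto_integral_mul_amplitude_cos h hlam (c1.intervalIntegrable_sub hπm)).add
    (tendsto_integral_mul_amplitude_sin h hlam (c2.intervalIntegrable_sub hπm)) using 2 with i
  · exact intervalIntegral.integral_add
      ((c1.fun_mul (h i).continuousOn_amplitude_cos).intervalIntegrable_sub hπm)
      ((c2.fun_mul (h i).continuousOn_amplitude_sin).intervalIntegrable_sub hπm)
  · simp

end Family

end IsPruferAngle
end DiracProblem

/-! ### Counting zeros and inverting the sine. -/

/-- The number of zeros of `cos ∘ θ` for an increasing angle `θ`. -/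
lemma encard_zeros_cos_comp {θ : ℝ → ℝ} {b : ℝ} {K : ℕ} (hb : 0 < b)
    (hc : ContinuousOn θ (Icc 0 b)) (hm : StrictMonoOn θ (Icc 0 b)) (h0 : -(π / 2) < θ 0)
    (h0' : θ 0 < π / 2) (h1 : ((K : ℝ) - 1 / 2) * π < θ b) (h2 : θ b ≤ ((K : ℝ) + 1 / 2) * π) :
    {t | t ∈ Ioo 0 b ∧ cos (θ t) = 0}.encard = K := by
  have h0m : (0 : ℝ) ∈ Icc 0 b := ⟨le_rfl, hb.le⟩
  have hbm : b ∈ Icc 0 b := ⟨hb.le, le_rfl⟩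
  have hinj : InjOn θ {t | t ∈ Ioo 0 b ∧ cos (θ t) = 0} :=
    hm.injOn.mono fun t ht => Ioo_subset_Icc_self ht.1
  have himg : θ '' {t | t ∈ Ioo 0 b ∧ cos (θ t) = 0}
      = (fun k : ℕ => ((k : ℝ) + 1 / 2) * π) '' (Finset.range K : Set ℕ) := by
    ext y
    constructor
    · rintro ⟨t, ⟨ht, hcos⟩, rfl⟩
      obtain ⟨k, hk⟩ := cos_eq_zero_iff.1 hcos
      have hlo : θ 0 < θ t := hm h0m (Ioo_subset_Icc_self ht) ht.1
      have hhi : θ t < θ b := hm (Ioo_subset_Icc_self ht) hbm ht.2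
      have hk0 : (-1 : ℝ) < k := by nlinarith [pi_pos]
      -- Equality is allowed in `h2`: then `b` is itself a zero, but `t < b` excludes it. This case
      -- counts the zeros to the left of a node.
      have hk1 : (k : ℝ) < K := by nlinarith [pi_pos]
      have hk0' : 0 ≤ k := by
        have : (-1 : ℤ) < k := by exact_mod_cast hk0
        omega
      lift k to ℕ using hk0'
      refine ⟨k, ?_, ?_⟩
      · simp only [Finset.coe_range, mem_Iio]
        exact_mod_cast hk1
      · rw [hk]
        push_cast
        ring
    · rintro ⟨k, hk, rfl⟩
      simp only [Finset.coe_range, mem_Iio] at hk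
      have hk' : (k : ℝ) + 1 ≤ K := by exact_mod_cast hk
      have hmem : ((k : ℝ) + 1 / 2) * π ∈ Ioo (θ 0) (θ b) := by
        constructor
        · nlinarith [pi_pos, (Nat.cast_nonneg k : (0 : ℝ) ≤ k)]
        · nlinarith [pi_pos]
      obtain ⟨t, ht, htk⟩ := intermediate_value_Ioo hb.le hc hmem
      refine ⟨t, ⟨ht, ?_⟩, htk⟩
      rw [htk]
      refine cos_eq_zero_iff.2 ⟨k, ?_⟩
      push_cast
      ring
  rw [← hinj.encard_image, himg, Function.Injective.encard_image, encard_coe_eq_coe_finsetCard,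
    Finset.card_range]
  intro a c hac
  have := mul_right_cancel₀ pi_pos.ne' hac
  have h3 : (a : ℝ) = c := by linarith
  exact_mod_cast h3

/-- Jordan's inequality `(2/π)|δ| ≤ |sin δ|` on `|δ| ≤ π/2`. -/
lemma tendsto_zero_of_tendsto_sin {ι : Type*} {l : Filter ι} {δ : ι → ℝ}
    (hδ : ∀ i, |δ i| ≤ π / 2) (hs : Tendsto (fun i => sin (δ i)) l (𝓝 0)) :
    Tendsto δ l (𝓝 0) := by
  have h1 : Tendsto (fun i => π / 2 * |sin (δ i)|) l (𝓝 0) := by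
    simpa using hs.abs.const_mul (π / 2)
  refine squeeze_zero_norm (fun i => ?_) h1
  have := mul_abs_le_abs_sin (hδ i)
  rw [Real.norm_eq_abs]
  rw [div_mul_eq_mul_div, div_le_iff₀ pi_pos] at this
  linarith

/-- `sin δ = δ sinc δ`, and `sinc δ → 1`. -/
lemma tendsto_mul_of_tendsto_mul_sin {ι : Type*} {l : Filter ι} {lam δ : ι → ℝ} {a : ℝ}
    (hδ : Tendsto δ l (𝓝 0)) (hs : Tendsto (fun i => lam i * sin (δ i)) l (𝓝 a)) :
    Tendsto (fun i => lam i * δ i) l (𝓝 a) := by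
  have h1 : Tendsto (fun i => sinc (δ i)) l (𝓝 1) := by
    simpa [Function.comp_def] using (continuous_sinc.tendsto 0).comp hδ
  have h2 := hs.div h1 one_ne_zero
  rw [div_one] at h2
  refine h2.congr' ?_
  filter_upwards [h1.eventually_ne one_ne_zero] with i hi
  rw [Pi.div_apply, div_eq_iff hi]
  by_cases h0 : δ i = 0
  · simp [h0]
  · rw [sinc_of_ne_zero h0]
    field_simp

/-! ### First order asymptotics along nodal families. -/

namespace DiracProblem

lemma continuousOn_omega (P : DiracProblem) : ContinuousOn P.ω (Icc 0 π) :=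
  fun _ hx => (hasDerivWithinAt_integral_Icc P.hV.continuousOn hx).continuousWithinAt

/-- A family of labelled nodal points, with the Prüfer angles of the eigenfunctions. -/
structure IsNodalFamily (P : DiracProblem) {ι : Type*} (l : Filter ι) (lam : ι → ℝ)
    (θ : ι → ℝ → ℝ) (n j : ι → ℕ) (x : ι → ℝ) : Prop where
  angle : ∀ i, P.IsPruferAngle (lam i) (θ i)
  near : ∀ i, |lam i - n i| < 1
  tendsto_n : Tendsto n l atTop
  card : ∀ i, {t | t ∈ Ioo 0 π ∧ cos (θ i t) = 0}.encard = n i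
  mem : ∀ i, x i ∈ Ioo 0 π
  cos_eq_zero : ∀ i, cos (θ i (x i)) = 0
  card_left : ∀ i, {t | t ∈ Ioo 0 (x i) ∧ cos (θ i t) = 0}.encard = j i

namespace IsNodalFamily

variable {P : DiracProblem} {ι : Type*} {l : Filter ι} {lam : ι → ℝ}
    {θ : ι → ℝ → ℝ} {n j : ι → ℕ} {x : ι → ℝ}

lemma mem_Icc (h : P.IsNodalFamily l lam θ n j x) (i : ι) : x i ∈ Icc 0 π :=
  Ioo_subset_Icc_self (h.mem i)

lemma tendsto_n_real (h : P.IsNodalFamily l lam θ n j x) :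
    Tendsto (fun i => (n i : ℝ)) l atTop := tendsto_natCast_atTop_atTop.comp h.tendsto_n

lemma tendsto_lam (h : P.IsNodalFamily l lam θ n j x) : Tendsto lam l atTop := by
  refine tendsto_atTop_mono (fun i => ?_) (tendsto_atTop_add_const_right l (-1) h.tendsto_n_real)
  have := (abs_lt.1 (h.near i)).1
  linarith

lemma tendsto_angle_zero (h : P.IsNodalFamily l lam θ n j x) :
    Tendsto (fun i => θ i 0 + P.α) l (𝓝 0) := by
  refine tendsto_zero_of_tendsto_sin (fun i => (h.angle i).abs_le) ?_
  simp only [(h.angle _).bc_zero]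
  exact IsPruferAngle.tendsto_nonlocal h.angle h.tendsto_lam P.hf₁ P.hf₂

lemma eventually_strictMonoOn (h : P.IsNodalFamily l lam θ n j x) :
    ∀ᶠ i in l, StrictMonoOn (θ i) (Icc 0 π) := by
  obtain ⟨M, -, hM⟩ := P.hV.continuousOn.exists_abs_le
  filter_upwards [h.tendsto_lam.eventually_gt_atTop (M + |P.m|)] with i hi
  refine strictMonoOn_of_hasDerivWithinAt_pos (convex_Icc _ _) (h.angle i).continuousOn
    (fun t ht => ((h.angle i).hasDeriv t (interior_subset ht)).mono interior_subset)
    fun t ht => ?_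
  have h1 := le_of_abs_le (hM t (interior_subset ht))
  have h2 : P.m * cos (2 * θ i t) ≤ |P.m| := by
    refine (le_abs_self _).trans ?_
    rw [abs_mul]
    exact mul_le_of_le_one_right (abs_nonneg _) (abs_cos_le_one _)
  linarith

lemma eventually_angle_zero_mem (h : P.IsNodalFamily l lam θ n j x)
    (hα : P.α ∈ Ioo (-(π / 2)) (π / 2)) :
    ∀ᶠ i in l, θ i 0 ∈ Ioo (-(π / 2)) (π / 2) := by
  have h1 : Tendsto (fun i => θ i 0) l (𝓝 (-P.α)) := by
    simpa using h.tendsto_angle_zero.sub_const P.α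
  exact h1.eventually_mem (Ioo_mem_nhds (by linarith [hα.2]) (by linarith [hα.1]))

/-- The boundary condition at `π` only puts `θ π + β` near some multiple `kπ`. As `|β| < π/2`, `θ π`
then lies strictly between `(k - 1/2)π` and `(k + 1/2)π`, so `cos θ` has exactly `k` zeros and `k =
n`. -/
lemma tendsto_angle_pi (h : P.IsNodalFamily l lam θ n j x)
    (hα : P.α ∈ Ioo (-(π / 2)) (π / 2)) (hβ : P.β ∈ Ioo (-(π / 2)) (π / 2)) :
    Tendsto (fun i => θ i π + P.β - n i * π) l (𝓝 0) := by
  have hs : Tendsto (fun i => sin (θ i π + P.β)) l (𝓝 0) := by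
    have h1 := (IsPruferAngle.tendsto_nonlocal h.angle h.tendsto_lam P.hg₁ P.hg₂).div
      (IsPruferAngle.tendsto_amplitude_pi h.angle h.tendsto_lam) one_ne_zero
    rw [zero_div] at h1
    refine h1.congr fun i => ?_
    rw [Pi.div_apply, ← (h.angle i).bc_pi, mul_div_cancel_left₀ _ (amplitude_pos _ _ _).ne']
  set k : ι → ℤ := fun i => round ((θ i π + P.β) / π) with hk
  set δ : ι → ℝ := fun i => θ i π + P.β - k i * π with hδ
  have hδle : ∀ i, |δ i| ≤ π / 2 := by
    intro i
    have h1 := abs_sub_round ((θ i π + P.β) / π)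
    have h2 : δ i = ((θ i π + P.β) / π - k i) * π := by
      simp only [hδ]
      field_simp
    rw [h2, abs_mul, abs_of_pos pi_pos]
    nlinarith [pi_pos]
  have hδ0 : Tendsto δ l (𝓝 0) := by
    refine tendsto_zero_of_tendsto_sin hδle ?_
    rw [tendsto_zero_iff_abs_tendsto_zero] at hs ⊢
    refine hs.congr fun i => ?_
    simp [hδ, sin_sub_int_mul_pi, abs_mul]
  refine hδ0.congr' ?_
  have hη : Ioo (P.β - π / 2) (P.β + π / 2) ∈ 𝓝 (0 : ℝ) :=
    Ioo_mem_nhds (by linarith [hβ.2]) (by linarith [hβ.1])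
  filter_upwards [hδ0.eventually_mem hη, h.eventually_strictMonoOn,
    h.eventually_angle_zero_mem hα] with i hi hmono h0
  have hlt : θ i 0 < θ i π := hmono ⟨le_rfl, pi_pos.le⟩ ⟨pi_pos.le, le_rfl⟩ pi_pos
  have hθπ : θ i π = k i * π - P.β + δ i := by
    simp only [hδ]
    ring
  have hk0 : (-1 : ℝ) < k i := by nlinarith [pi_pos, hi.1, hi.2, h0.1]
  have hk0' : 0 ≤ k i := by
    have : (-1 : ℤ) < k i := by exact_mod_cast hk0
    omega
  obtain ⟨K, hK⟩ := Int.eq_ofNat_of_zero_le hk0'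
  have hKr : (k i : ℝ) = K := by rw [hK]; simp
  have hcard := encard_zeros_cos_comp (K := K) pi_pos (h.angle i).continuousOn hmono h0.1 h0.2
    (by rw [hθπ, hKr]; linarith [hi.1]) (by rw [hθπ, hKr]; linarith [hi.2])
  rw [h.card i] at hcard
  have hnK : n i = K := by exact_mod_cast hcard
  simp only [hδ, hKr, hnK]

/-- The increasing angle starts in `(-π/2, π/2)` and meets the values `π/2, 3π/2, …` in order, so
the number of earlier zeros determines the value at the node. -/
lemma eventually_angle_eq (h : P.IsNodalFamily l lam θ n j x)
    (hα : P.α ∈ Ioo (-(π / 2)) (π / 2)) :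
    ∀ᶠ i in l, θ i (x i) = ((j i : ℝ) + 1 / 2) * π := by
  filter_upwards [h.eventually_strictMonoOn, h.eventually_angle_zero_mem hα] with i hmono h0
  have hx := h.mem_Icc i
  have hlt : θ i 0 < θ i (x i) := hmono ⟨le_rfl, pi_pos.le⟩ hx (h.mem i).1
  obtain ⟨k, hk⟩ := cos_eq_zero_iff.1 (h.cos_eq_zero i)
  have hk0 : (-1 : ℝ) < k := by nlinarith [pi_pos, h0.1]
  have hk0' : 0 ≤ k := by
    have : (-1 : ℤ) < k := by exact_mod_cast hk0
    omega
  lift k to ℕ using hk0'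
  push_cast at hk
  have hsub : Icc 0 (x i) ⊆ Icc 0 π := Icc_subset_Icc_right hx.2
  have hcard := encard_zeros_cos_comp (K := k) (h.mem i).1
    ((h.angle i).continuousOn.mono hsub) (hmono.mono hsub) h0.1 h0.2
    (by rw [hk]; linarith [pi_pos]) (by rw [hk]; linarith)
  rw [h.card_left i] at hcard
  have hnk : j i = k := by exact_mod_cast hcard
  rw [hk, hnk]
  ring

lemma tendsto_sin_two_angle_zero (h : P.IsNodalFamily l lam θ n j x) :
    Tendsto (fun i => sin (2 * θ i 0)) l (𝓝 (-sin (2 * P.α))) := by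
  have h1 : Tendsto (fun i => 2 * θ i 0) l (𝓝 (-(2 * P.α))) := by
    convert (h.tendsto_angle_zero.sub_const P.α).const_mul 2 using 2 <;> ring
  rw [← sin_neg]
  exact (continuous_sin.tendsto _).comp h1

lemma tendsto_sin_two_angle_pi (h : P.IsNodalFamily l lam θ n j x)
    (hα : P.α ∈ Ioo (-(π / 2)) (π / 2)) (hβ : P.β ∈ Ioo (-(π / 2)) (π / 2)) :
    Tendsto (fun i => sin (2 * θ i π)) l (𝓝 (-sin (2 * P.β))) := by
  have h1 : Tendsto (fun i => 2 * ((θ i π + P.β - n i * π) - P.β)) l (𝓝 (-(2 * P.β))) := by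
    convert ((h.tendsto_angle_pi hα hβ).sub_const P.β).const_mul 2 using 2; ring
  rw [← sin_neg]
  refine ((continuous_sin.tendsto _).comp h1).congr fun i => ?_
  have : 2 * (θ i π + P.β - n i * π - P.β) = 2 * θ i π - n i * (2 * π) := by ring
  rw [Function.comp_apply, this, sin_sub_nat_mul_two_pi]

/-- First order eigenvalue asymptotics. -/
lemma tendsto_lam_sub (h : P.IsNodalFamily l lam θ n j x)
    (hα : P.α ∈ Ioo (-(π / 2)) (π / 2)) (hβ : P.β ∈ Ioo (-(π / 2)) (π / 2)) (hω : P.ω π = 0) :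
    Tendsto (fun i => lam i - n i) l (𝓝 ((P.α - P.β) / π)) := by
  have h1 := h.tendsto_angle_pi hα hβ
  have h2 := h.tendsto_angle_zero
  have h3 := IsPruferAngle.tendsto_integral_cos_two h.angle h.tendsto_lam
    (x := fun _ => π) (fun _ => ⟨pi_pos.le, le_rfl⟩)
  have h4 := (((h1.sub h2).add (h3.const_mul P.m)).add_const (P.α - P.β)).div_const π
  convert h4 using 2 with i
  · have := (h.angle i).angle_eq (⟨pi_pos.le, le_rfl⟩ : π ∈ Icc (0 : ℝ) π)
    rw [hω] at this
    rw [eq_div_iff pi_pos.ne', this]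
    ring
  · ring

lemma tendsto_omega (h : P.IsNodalFamily l lam θ n j x) {x₀ : ℝ} (hx₀ : x₀ ∈ Icc 0 π)
    (hx : Tendsto x l (𝓝 x₀)) : Tendsto (fun i => P.ω (x i)) l (𝓝 (P.ω x₀)) :=
  (P.continuousOn_omega x₀ hx₀).tendsto.comp
    (tendsto_nhdsWithin_iff.2 ⟨hx, Eventually.of_forall h.mem_Icc⟩)

/-- First order asymptotics of the nodal points. -/
lemma tendsto_nodal_first (h : P.IsNodalFamily l lam θ n j x)
    (hα : P.α ∈ Ioo (-(π / 2)) (π / 2)) (hβ : P.β ∈ Ioo (-(π / 2)) (π / 2)) (hω : P.ω π = 0)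
    {x₀ : ℝ} (hx₀ : x₀ ∈ Icc 0 π) (hx : Tendsto x l (𝓝 x₀)) :
    Tendsto (fun i => n i * x i - ((j i : ℝ) + 1 / 2) * π) l
      (𝓝 (P.ω x₀ + (P.β - P.α) * x₀ / π + P.α)) := by
  have h1 := h.tendsto_angle_zero
  have h2 := h.tendsto_lam_sub hα hβ hω
  have h3 := h.tendsto_omega hx₀ hx
  have h4 := IsPruferAngle.tendsto_integral_cos_two h.angle h.tendsto_lam h.mem_Icc
  have h5 := (((h3.sub (h2.mul hx)).sub h1).add (h4.const_mul P.m)).add_const P.α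
  have e : P.ω x₀ - (P.α - P.β) / π * x₀ - 0 + P.m * 0 + P.α
      = P.ω x₀ + (P.β - P.α) * x₀ / π + P.α := by ring
  rw [e] at h5
  refine h5.congr' ?_
  filter_upwards [h.eventually_angle_eq hα] with i hi
  have := (h.angle i).angle_eq (h.mem_Icc i)
  rw [hi] at this
  linear_combination this

/-! ### Second order asymptotics for `n` of fixed parity. -/

section Parity

variable {σ : ℝ}

/-- The boundary values left by integration by parts converge because `θ 0 → -α` and `θ π - nπ →
-β`; removing `nπ` from the sine and cosine at `π` costs the factor `σ`. -/
lemma tendsto_lam_mul_nonlocal (h : P.IsNodalFamily l lam θ n j x)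
    (hα : P.α ∈ Ioo (-(π / 2)) (π / 2)) (hβ : P.β ∈ Ioo (-(π / 2)) (π / 2))
    (hσ : ∀ i, (-1 : ℝ) ^ n i = σ) {f₁ f₂ : ℝ → ℝ} (hf₁ : IsW12 f₁) (hf₂ : IsW12 f₂) :
    Tendsto (fun i => lam i * ∫ x in (0 : ℝ)..π, (f₁ x * (amplitude P.m (θ i) x * cos (θ i x))
        + f₂ x * (amplitude P.m (θ i) x * sin (θ i x)))) l
      (𝓝 ((f₁ 0 * sin P.α + f₂ 0 * cos P.α) - σ * (f₁ π * sin P.β + f₂ π * cos P.β))) := by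
  have h0 : Tendsto (fun i => θ i 0) l (𝓝 (-P.α)) := by
    simpa using h.tendsto_angle_zero.sub_const P.α
  have hπ : Tendsto (fun i => θ i π + P.β - n i * π - P.β) l (𝓝 (-P.β)) := by
    simpa using (h.tendsto_angle_pi hα hβ).sub_const P.β
  have heq : ∀ i, θ i π = (θ i π + P.β - n i * π - P.β) + n i * π := fun i => by ring
  have hsin : Tendsto (fun i => sin (θ i π)) l (𝓝 (σ * -sin P.β)) := by
    rw [← sin_neg]
    refine (((continuous_sin.tendsto _).comp hπ).const_mul σ).congr fun i => ?_
    rw [Function.comp_apply, ← hσ i, ← sin_add_nat_mul_pi, ← heq]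
  have hcos : Tendsto (fun i => cos (θ i π)) l (𝓝 (σ * cos P.β)) := by
    rw [← cos_neg P.β]
    refine (((continuous_cos.tendsto _).comp hπ).const_mul σ).congr fun i => ?_
    rw [Function.comp_apply, ← hσ i, ← cos_add_nat_mul_pi, ← heq]
  have hsin0 : Tendsto (fun i => sin (θ i 0)) l (𝓝 (-sin P.α)) := by
    rw [← sin_neg]
    exact (continuous_sin.tendsto _).comp h0
  have hcos0 : Tendsto (fun i => cos (θ i 0)) l (𝓝 (cos P.α)) := by
    rw [← cos_neg P.α]
    exact (continuous_cos.tendsto _).comp h0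
  have key := (IsPruferAngle.tendsto_lam_mul_nonlocal_sub h.angle h.tendsto_lam hf₁ hf₂).add
    (((IsPruferAngle.tendsto_amplitude_pi h.angle h.tendsto_lam).mul
      ((hsin.const_mul (f₁ π)).sub (hcos.const_mul (f₂ π)))).sub
      ((hsin0.const_mul (f₁ 0)).sub (hcos0.const_mul (f₂ 0))))
  convert key using 2 with i <;> ring

lemma tendsto_lam_mul_angle_zero (h : P.IsNodalFamily l lam θ n j x)
    (hα : P.α ∈ Ioo (-(π / 2)) (π / 2)) (hβ : P.β ∈ Ioo (-(π / 2)) (π / 2))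
    (hσ : ∀ i, (-1 : ℝ) ^ n i = σ) :
    Tendsto (fun i => lam i * (θ i 0 + P.α)) l (𝓝 (P.F₀ - σ * P.Fπ)) := by
  refine tendsto_mul_of_tendsto_mul_sin h.tendsto_angle_zero ?_
  simp only [(h.angle _).bc_zero]
  exact h.tendsto_lam_mul_nonlocal hα hβ hσ P.hf₁ P.hf₂

lemma tendsto_lam_mul_angle_pi (h : P.IsNodalFamily l lam θ n j x)
    (hα : P.α ∈ Ioo (-(π / 2)) (π / 2)) (hβ : P.β ∈ Ioo (-(π / 2)) (π / 2))
    (hσ : ∀ i, (-1 : ℝ) ^ n i = σ) (hσ2 : σ * σ = 1) :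
    Tendsto (fun i => lam i * (θ i π + P.β - n i * π)) l (𝓝 (σ * P.G₀ - P.Gπ)) := by
  refine tendsto_mul_of_tendsto_mul_sin (h.tendsto_angle_pi hα hβ) ?_
  -- The factor `σ` comes from `sin (φ - nπ) = (-1)^n sin φ`; the division by the amplitude comes
  -- from the boundary condition.
  have h1 := ((h.tendsto_lam_mul_nonlocal hα hβ hσ P.hg₁ P.hg₂).div
    (IsPruferAngle.tendsto_amplitude_pi h.angle h.tendsto_lam) one_ne_zero).const_mul σ
  have e : σ * ((P.g₁ 0 * sin P.α + P.g₂ 0 * cos P.α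
      - σ * (P.g₁ π * sin P.β + P.g₂ π * cos P.β)) / 1) = σ * P.G₀ - P.Gπ := by
    rw [G₀, Gπ]
    linear_combination -(P.g₁ π * sin P.β + P.g₂ π * cos P.β) * hσ2
  rw [e] at h1
  refine h1.congr fun i => ?_
  rw [Pi.div_apply, ← (h.angle i).bc_pi, sin_sub_nat_mul_pi, hσ]
  have := (amplitude_pos P.m (θ i) π).ne'
  field_simp

/-- Second order eigenvalue asymptotics. -/
lemma tendsto_lam_mul_lam_sub (h : P.IsNodalFamily l lam θ n j x)
    (hα : P.α ∈ Ioo (-(π / 2)) (π / 2)) (hβ : P.β ∈ Ioo (-(π / 2)) (π / 2)) (hω : P.ω π = 0)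
    (hσ : ∀ i, (-1 : ℝ) ^ n i = σ) (hσ2 : σ * σ = 1) :
    Tendsto (fun i => lam i * (lam i - n i - (P.α - P.β) / π)) l
      (𝓝 ((P.A₁ + σ * P.A₂) / π)) := by
  have hπm : π ∈ Icc (0 : ℝ) π := ⟨pi_pos.le, le_rfl⟩
  have h1 := h.tendsto_lam_mul_angle_zero hα hβ hσ
  have h2 := h.tendsto_lam_mul_angle_pi hα hβ hσ hσ2
  have h3 := IsPruferAngle.tendsto_lam_mul_integral_cos_two h.angle h.tendsto_lam
    (x := fun _ => π) (fun _ => hπm) tendsto_const_nhds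
    (h.tendsto_sin_two_angle_pi hα hβ) h.tendsto_sin_two_angle_zero
  convert ((h2.sub h1).add (h3.const_mul P.m)).div_const π using 2 with i
  · have := (h.angle i).angle_eq hπm
    rw [hω] at this
    rw [eq_div_iff pi_pos.ne', this]
    field_simp
    ring
  · have hs : sin (2 * P.α) - sin (2 * P.β) = 2 * (cos (P.β + P.α) * sin (P.α - P.β)) := by
      rw [sin_sub_sin]
      ring_nf
    rw [A₁, A₂]
    congr 1
    linear_combination (-P.m / 2) * hs

/-- Second order asymptotics of the nodal points. -/
lemma tendsto_nodal_second (h : P.IsNodalFamily l lam θ n j x)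
    (hα : P.α ∈ Ioo (-(π / 2)) (π / 2)) (hβ : P.β ∈ Ioo (-(π / 2)) (π / 2)) (hω : P.ω π = 0)
    (hσ : ∀ i, (-1 : ℝ) ^ n i = σ) (hσ2 : σ * σ = 1) {x₀ : ℝ} (hx : Tendsto x l (𝓝 x₀)) :
    Tendsto (fun i => n i * (n i * x i - ((j i : ℝ) + 1 / 2) * π
        - (P.ω (x i) + (P.β - P.α) * x i / π + P.α))) l
      (𝓝 (-((P.A₁ + σ * P.A₂) / π) * x₀ - (P.F₀ - σ * P.Fπ)
        + P.m * (sin (2 * P.α) / 2 + P.m * x₀ / 2))) := by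
  -- The expansions carry a factor `lam`, the nodal quantity a factor `n`; the ratio tends to `1`.
  have hratio : Tendsto (fun i => (n i : ℝ) / lam i) l (𝓝 1) := by
    have h1 : Tendsto (fun i => 1 - (lam i - n i) / lam i) l (𝓝 (1 - 0)) := by
      have := (h.tendsto_lam_sub hα hβ hω).div_atTop h.tendsto_lam
      exact this.const_sub 1
    rw [sub_zero] at h1
    refine h1.congr' ?_
    filter_upwards [h.tendsto_lam.eventually_gt_atTop 0] with i hi
    field_simp
    ring
  have hsx : Tendsto (fun i => sin (2 * θ i (x i))) l (𝓝 0) := by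
    refine tendsto_const_nhds.congr fun i => ?_
    rw [sin_two_mul, h.cos_eq_zero i, mul_zero]
  have h1 := h.tendsto_lam_mul_angle_zero hα hβ hσ
  have h2 := h.tendsto_lam_mul_lam_sub hα hβ hω hσ hσ2
  have h3 := IsPruferAngle.tendsto_lam_mul_integral_cos_two h.angle h.tendsto_lam
    h.mem_Icc hx hsx h.tendsto_sin_two_angle_zero
  have h4 := hratio.mul (((h2.mul hx).neg.sub h1).add (h3.const_mul P.m))
  have e : 1 * (-((P.A₁ + σ * P.A₂) / π * x₀) - (P.F₀ - σ * P.Fπ)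
      + P.m * ((0 - -sin (2 * P.α)) / 2 + P.m * x₀ / 2))
      = -((P.A₁ + σ * P.A₂) / π) * x₀ - (P.F₀ - σ * P.Fπ)
        + P.m * (sin (2 * P.α) / 2 + P.m * x₀ / 2) := by ring
  rw [e] at h4
  refine h4.congr' ?_
  filter_upwards [h.tendsto_lam.eventually_gt_atTop 0, h.eventually_angle_eq hα] with i hi hθ
  have key := (h.angle i).angle_eq (h.mem_Icc i)
  rw [hθ] at key
  rw [div_mul_eq_mul_div, div_eq_iff hi.ne']
  linear_combination (n i : ℝ) * lam i * key

end Parity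

lemma tendsto_nodalQ₁ (h : P.IsNodalFamily l lam θ n j x)
    (hα : P.α ∈ Ioo (-(π / 2)) (π / 2)) (hβ : P.β ∈ Ioo (-(π / 2)) (π / 2)) (hω : P.ω π = 0)
    {x₀ : ℝ} (hx₀ : x₀ ∈ Icc 0 π) (hx : Tendsto x l (𝓝 x₀)) :
    Tendsto (fun i => nodalQ₁ (n i, j i, x i)) l
      (𝓝 (P.ω x₀ + (P.β - P.α) * x₀ / π + P.α)) := by
  refine (h.tendsto_nodal_first hα hβ hω hx₀ hx).congr' ?_
  filter_upwards [h.tendsto_n.eventually_gt_atTop 0] with i hi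
  have : (n i : ℝ) ≠ 0 := by exact_mod_cast hi.ne'
  simp only [nodalQ₁]
  field_simp

/-- `nodalQ₂` has `(j + 1/2)π / n` where the preceding expansion has `x` in the term with `β - α`.
The exchange adds `(β - α)(n x - (j + 1/2)π)`, whose limit is `β - α` times the first limit
function. -/
lemma tendsto_nodalQ₂ (h : P.IsNodalFamily l lam θ n j x)
    (hα : P.α ∈ Ioo (-(π / 2)) (π / 2)) (hβ : P.β ∈ Ioo (-(π / 2)) (π / 2)) (hω : P.ω π = 0)
    {σ : ℝ} (hσ : ∀ i, (-1 : ℝ) ^ n i = σ) (hσ2 : σ * σ = 1)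
    {x₀ : ℝ} (hx₀ : x₀ ∈ Icc 0 π) (hx : Tendsto x l (𝓝 x₀)) :
    Tendsto (fun i => nodalQ₂ P.ω P.α P.β (n i, j i, x i)) l
      (𝓝 ((P.β - P.α) * (P.ω x₀ + P.α) + (P.β - P.α) ^ 2 * x₀ / π - x₀ * (P.A₁ + σ * P.A₂)
        + π * (P.m ^ 2 * x₀ / 2 + P.m * sin (2 * P.α) / 2 + σ * P.Fπ - P.F₀))) := by
  have h1 := ((h.tendsto_nodal_second hα hβ hω hσ hσ2 hx).const_mul π).add
    ((h.tendsto_nodal_first hα hβ hω hx₀ hx).const_mul (P.β - P.α))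
  have e : π * (-((P.A₁ + σ * P.A₂) / π) * x₀ - (P.F₀ - σ * P.Fπ)
        + P.m * (sin (2 * P.α) / 2 + P.m * x₀ / 2))
      + (P.β - P.α) * (P.ω x₀ + (P.β - P.α) * x₀ / π + P.α)
      = (P.β - P.α) * (P.ω x₀ + P.α) + (P.β - P.α) ^ 2 * x₀ / π - x₀ * (P.A₁ + σ * P.A₂)
        + π * (P.m ^ 2 * x₀ / 2 + P.m * sin (2 * P.α) / 2 + σ * P.Fπ - P.F₀) := by
    field_simp
    ring
  rw [e] at h1
  refine h1.congr' ?_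
  filter_upwards [h.tendsto_n.eventually_gt_atTop 0] with i hi
  have : (n i : ℝ) ≠ 0 := by exact_mod_cast hi.ne'
  simp only [nodalQ₂]
  field_simp
  ring

end IsNodalFamily
end DiracProblem

/-! ### Limit functions, reconstruction and uniqueness. -/

/-- Every point of `[0,π]` is approached along a dense set of labelled points. -/
lemma NodalDense.exists_approachesIn {X : Set (ℕ × ℕ × ℝ)} (hX : NodalDense X) {x : ℝ}
    (hx : x ∈ Icc 0 π) : ∃ s, ApproachesIn X x s := by
  have hcl : ∀ N : ℕ, x ∈ closure {x | ∃ n j : ℕ, N ≤ n ∧ (n, j, x) ∈ X} := by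
    intro N
    have h1 := closure_minimal (hX N) isClosed_closure
    rw [closure_Ioo pi_pos.ne] at h1
    exact h1 hx
  have hex : ∀ k : ℕ, ∃ p ∈ X, k ≤ p.1 ∧ dist p.2.2 x < 1 / ((k : ℝ) + 1) := by
    intro k
    obtain ⟨y, ⟨n, j, hn, hy⟩, hd⟩ :=
      Metric.mem_closure_iff.1 (hcl k) (1 / ((k : ℝ) + 1)) (by positivity)
    exact ⟨(n, j, y), hy, hn, by rwa [dist_comm]⟩
  choose s hs hn hd using hex
  refine ⟨s, hs, tendsto_atTop_mono hn tendsto_id, tendsto_iff_dist_tendsto_zero.2 ?_⟩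
  exact squeeze_zero (fun _ => dist_nonneg) (fun k => (hd k).le)
    tendsto_one_div_add_atTop_nhds_zero_nat

/-- This is the source of uniqueness: the limit along any one approaching sequence already
determines the value. -/
lemma IsLimitFunction.eqOn {X : Set (ℕ × ℕ × ℝ)} {q q' : ℕ × ℕ × ℝ → ℝ} {ψ ψ' : ℝ → ℝ}
    (h : IsLimitFunction X q ψ) (h' : IsLimitFunction X q' ψ') (hq : EqOn q q' X) :
    EqOn ψ ψ' (Icc 0 π) := by
  intro x hx
  obtain ⟨s, hs⟩ := (h x hx).1
  refine tendsto_nhds_unique ((h x hx).2 s hs) (((h' x hx).2 s hs).congr fun k => ?_)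
  exact (hq (hs.1 k)).symm

namespace DiracProblem

/-- Eigenvalue and angle are chosen separately for each term; no relation between different
eigenfunctions is needed. -/
lemma exists_isNodalFamily {P : DiracProblem} {X : Set (ℕ × ℕ × ℝ)} (hX : X ⊆ P.nodalPoints)
    {x : ℝ} {s : ℕ → ℕ × ℕ × ℝ} (hs : ApproachesIn X x s) :
    ∃ lam θ, P.IsNodalFamily atTop lam θ (fun k => (s k).1) (fun k => (s k).2.1)
      (fun k => (s k).2.2) := by
  have hex : ∀ k, ∃ (lam : ℝ) (θ : ℝ → ℝ), P.IsPruferAngle lam θ ∧ |lam - (s k).1| < 1 ∧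
      {t | t ∈ Ioo 0 π ∧ cos (θ t) = 0}.encard = (s k).1 ∧ (s k).2.2 ∈ Ioo 0 π ∧
      cos (θ (s k).2.2) = 0 ∧
      {t | t ∈ Ioo 0 (s k).2.2 ∧ cos (θ t) = 0}.encard = (s k).2.1 := by
    intro k
    obtain ⟨lam, y₁, y₂, hE, hnear, hcard, ⟨hmem, hzero⟩, hleft⟩ := hX (hs.1 k)
    obtain ⟨θ, hθ, hiff⟩ := hE.exists_pruferAngle
    have hset : zerosIn y₁ = {t | t ∈ Ioo 0 π ∧ cos (θ t) = 0} := by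
      ext t
      exact and_congr_right fun ht => hiff t (Ioo_subset_Icc_self ht)
    refine ⟨lam, θ, hθ, hnear, hset ▸ hcard, hmem,
      (hiff _ (Ioo_subset_Icc_self hmem)).1 hzero, ?_⟩
    rw [← hleft, hset]
    congr 1
    ext t
    simp only [mem_ofPred_eq, mem_inter_iff, mem_Ioo, mem_Iio]
    constructor
    · rintro ⟨⟨h1, h2⟩, h3⟩
      exact ⟨⟨⟨h1, h2.trans hmem.2⟩, h3⟩, h2⟩
    · rintro ⟨⟨⟨h1, -⟩, h3⟩, h2⟩
      exact ⟨⟨h1, h2⟩, h3⟩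
  choose lam θ h1 h2 h3 h4 h5 h6 using hex
  exact ⟨lam, θ, h1, h2, hs.2.1, h3, h4, h5, h6⟩

variable {P Q : DiracProblem} {X : Set (ℕ × ℕ × ℝ)}

lemma isLimitFunction_nodalQ₁ (hα : P.α ∈ Ioo (-(π / 2)) (π / 2))
    (hβ : P.β ∈ Ioo (-(π / 2)) (π / 2)) (hω : P.ω π = 0) (hX : X ⊆ P.nodalPoints)
    (hdense : NodalDense X) :
    IsLimitFunction X nodalQ₁ fun x => P.ω x + (P.β - P.α) * x / π + P.α := by
  refine fun x hx => ⟨hdense.exists_approachesIn hx, fun s hs => ?_⟩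
  obtain ⟨lam, θ, h⟩ := exists_isNodalFamily hX hs
  exact h.tendsto_nodalQ₁ hα hβ hω hx hs.2.2

/-- The limit function of second order along the `n` with `(-1) ^ n = σ`. -/
def secondLimit (P : DiracProblem) (σ x : ℝ) : ℝ :=
  (P.β - P.α) * (P.ω x + P.α) + (P.β - P.α) ^ 2 * x / π - x * (P.A₁ + σ * P.A₂)
    + π * (P.m ^ 2 * x / 2 + P.m * sin (2 * P.α) / 2 + σ * P.Fπ - P.F₀)

lemma isLimitFunction_nodalQ₂ (hα : P.α ∈ Ioo (-(π / 2)) (π / 2))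
    (hβ : P.β ∈ Ioo (-(π / 2)) (π / 2)) (hω : P.ω π = 0) (hX : X ⊆ P.nodalPoints)
    (hdense : NodalDense X) {σ : ℝ} (hσ : ∀ p ∈ X, (-1 : ℝ) ^ p.1 = σ) (hσ2 : σ * σ = 1) :
    IsLimitFunction X (nodalQ₂ P.ω P.α P.β) (P.secondLimit σ) := by
  refine fun x hx => ⟨hdense.exists_approachesIn hx, fun s hs => ?_⟩
  obtain ⟨lam, θ, h⟩ := exists_isNodalFamily hX hs
  exact h.tendsto_nodalQ₂ hα hβ hω (fun k => hσ _ (hs.1 k)) hσ2 hx hs.2.2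

lemma isLimitFunction_evenPart (hα : P.α ∈ Ioo (-(π / 2)) (π / 2))
    (hβ : P.β ∈ Ioo (-(π / 2)) (π / 2)) (hω : P.ω π = 0) (hX : X ⊆ P.nodalPoints)
    (hdense : NodalDense (evenPart X)) :
    IsLimitFunction (evenPart X) (nodalQ₂ P.ω P.α P.β) (P.secondLimit 1) :=
  isLimitFunction_nodalQ₂ hα hβ hω (fun _ hp => hX hp.1) hdense
    (fun _ hp => hp.2.neg_one_pow) (by norm_num)

lemma isLimitFunction_oddPart (hα : P.α ∈ Ioo (-(π / 2)) (π / 2))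
    (hβ : P.β ∈ Ioo (-(π / 2)) (π / 2)) (hω : P.ω π = 0) (hX : X ⊆ P.nodalPoints)
    (hdense : NodalDense (oddPart X)) :
    IsLimitFunction (oddPart X) (nodalQ₂ P.ω P.α P.β) (P.secondLimit (-1)) :=
  isLimitFunction_nodalQ₂ hα hβ hω (fun _ hp => hX hp.1) hdense
    (fun _ hp => hp.2.neg_one_pow) (by norm_num)

lemma secondLimit_zero (P : DiracProblem) (σ : ℝ) : P.secondLimit σ 0
    = (P.β - P.α) * P.α + π * (P.m * sin (2 * P.α) / 2 + σ * P.Fπ - P.F₀) := by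
  simp [secondLimit, ω]

/-- At `π` the constants `A₁, A₂` cancel `F₀`, `Fπ` and the `m²` term, and the sine difference
formula turns `sin 2α` into `sin 2β`; only `G₀` and `Gπ` remain. -/
lemma secondLimit_pi (hω : P.ω π = 0) (σ : ℝ) :
    P.secondLimit σ π
      = (P.β - P.α) * P.β + π * (P.m * sin (2 * P.β) / 2 - σ * P.G₀ + P.Gπ) := by
  have hs : sin (2 * P.α) - sin (2 * P.β) = 2 * (cos (P.β + P.α) * sin (P.α - P.β)) := by
    rw [sin_sub_sin]
    ring_nf
  rw [secondLimit, hω, A₁, A₂, mul_div_cancel_right₀ _ pi_pos.ne']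
  linear_combination (π * P.m / 2) * hs

/-- The endpoint values are affine in `σ`: their difference over `σ = ±1` isolates the coefficient
of `σ`, their sum the constant term. -/
lemma Fπ_eq (P : DiracProblem) :
    P.Fπ = (P.secondLimit 1 0 - P.secondLimit (-1) 0) / (2 * π) := by
  rw [secondLimit_zero, secondLimit_zero]
  field_simp
  ring

lemma F₀_eq (P : DiracProblem) :
    P.F₀ = -(P.secondLimit 1 0 + P.secondLimit (-1) 0) / (2 * π) + P.α * (P.β - P.α) / π
      + P.m * sin (2 * P.α) / 2 := by
  rw [secondLimit_zero, secondLimit_zero]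
  field_simp
  ring

lemma G₀_eq (hω : P.ω π = 0) :
    P.G₀ = (P.secondLimit (-1) π - P.secondLimit 1 π) / (2 * π) := by
  rw [secondLimit_pi hω, secondLimit_pi hω]
  field_simp
  ring

lemma Gπ_eq (hω : P.ω π = 0) :
    P.Gπ = (P.secondLimit (-1) π + P.secondLimit 1 π) / (2 * π) - P.β * (P.β - P.α) / π
      - P.m * sin (2 * P.β) / 2 := by
  rw [secondLimit_pi hω, secondLimit_pi hω]
  field_simp
  ring

lemma hasDerivAt_omega (P : DiracProblem) {x : ℝ} (hx : x ∈ Ioo 0 π) :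
    HasDerivAt P.ω (P.V x) x :=
  (hasDerivWithinAt_integral_Icc P.hV.continuousOn (Ioo_subset_Icc_self hx)).hasDerivAt
    (Icc_mem_nhds hx.1 hx.2)

lemma hasDerivAt_firstLimit (P : DiracProblem) {x : ℝ} (hx : x ∈ Ioo 0 π) :
    HasDerivAt (fun x => P.ω x + (P.β - P.α) * x / π + P.α) (P.V x + (P.β - P.α) / π) x := by
  simpa using ((P.hasDerivAt_omega hx).add
    (((hasDerivAt_id x).const_mul (P.β - P.α)).div_const π)).add_const P.α

/-- Problems that share a dense set of labelled nodal points have the same angles and the same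
potential. -/
lemma eq_of_common_nodalPoints (hα : P.α ∈ Ioo (-(π / 2)) (π / 2))
    (hβ : P.β ∈ Ioo (-(π / 2)) (π / 2)) (hω : P.ω π = 0) (hX : X ⊆ P.nodalPoints)
    (hα' : Q.α ∈ Ioo (-(π / 2)) (π / 2)) (hβ' : Q.β ∈ Ioo (-(π / 2)) (π / 2))
    (hω' : Q.ω π = 0) (hX' : X ⊆ Q.nodalPoints) (hdense : NodalDense X) :
    Q.α = P.α ∧ Q.β = P.β ∧ EqOn Q.ω P.ω (Icc 0 π) ∧ EqOn Q.V P.V (Icc 0 π) := by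
  have hψ := (isLimitFunction_nodalQ₁ hα' hβ' hω' hX' hdense).eqOn
    (isLimitFunction_nodalQ₁ hα hβ hω hX hdense) fun _ _ => rfl
  -- The endpoints yield the angles: `ω` vanishes at `0` by definition and at `π` by assumption.
  have h0 := hψ (⟨le_rfl, pi_pos.le⟩ : (0 : ℝ) ∈ Icc 0 π)
  have hπ := hψ (⟨pi_pos.le, le_rfl⟩ : π ∈ Icc (0 : ℝ) π)
  have hae : Q.α = P.α := by simpa [ω] using h0
  have hbe : Q.β = P.β := by
    simp only [hω, hω', hae, mul_div_cancel_right₀ _ pi_pos.ne'] at hπ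
    linarith
  have hωe : EqOn Q.ω P.ω (Icc 0 π) := by
    intro x hx
    have := hψ hx
    simp only [hae, hbe] at this
    linarith
  have hVe : EqOn Q.V P.V (Ioo 0 π) := by
    intro x hx
    have heq : Q.ω =ᶠ[𝓝 x] P.ω :=
      (hωe.mono Ioo_subset_Icc_self).eventuallyEq_of_mem (Ioo_mem_nhds hx.1 hx.2)
    exact ((Q.hasDerivAt_omega hx).congr_of_eventuallyEq heq.symm).unique
      (P.hasDerivAt_omega hx)
  refine ⟨hae, hbe, hωe, ?_⟩
  -- Differentiation gives equality in the open interval; continuity extends it to the endpoints.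
  refine hVe.of_subset_closure Q.hV.continuousOn P.hV.continuousOn Ioo_subset_Icc_self ?_
  rw [closure_Ioo pi_pos.ne]

end DiracProblem

end

theorem theorem1 (P : DiracProblem)
    (hα : P.α ∈ Ioo (-(π / 2)) (π / 2)) (hβ : P.β ∈ Ioo (-(π / 2)) (π / 2))
    (hω : P.ω π = 0)
    (X : Set (ℕ × ℕ × ℝ)) (hX : X ⊆ P.nodalPoints) (hdense : NodalDense X) :
    -- reconstruction of `α`, `β` and `V`
    (∃ ψ₁ : ℝ → ℝ, IsLimitFunction X nodalQ₁ ψ₁ ∧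
      (∀ x ∈ Icc (0 : ℝ) π, ψ₁ x = P.ω x + (P.β - P.α) * x / π + P.α) ∧
      P.α = ψ₁ 0 ∧ P.β = ψ₁ π ∧
      ∀ x ∈ Ioo (0 : ℝ) π, DifferentiableAt ℝ ψ₁ x ∧
        P.V x = deriv ψ₁ x + (P.α - P.β) / π) ∧
    -- reconstruction of `Fπ`, `G₀` and, by means of `m`, of `F₀`, `Gπ`
    (NodalDense (evenPart X) → NodalDense (oddPart X) →
      ∃ ψp ψm : ℝ → ℝ,
        IsLimitFunction (evenPart X) (nodalQ₂ P.ω P.α P.β) ψp ∧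
        IsLimitFunction (oddPart X) (nodalQ₂ P.ω P.α P.β) ψm ∧
        (∀ x ∈ Icc (0 : ℝ) π, ψp x = (P.β - P.α) * (P.ω x + P.α)
          + (P.β - P.α) ^ 2 * x / π - x * (P.A₁ + P.A₂)
          + π * (P.m ^ 2 * x / 2 + P.m * sin (2 * P.α) / 2 + P.Fπ - P.F₀)) ∧
        (∀ x ∈ Icc (0 : ℝ) π, ψm x = (P.β - P.α) * (P.ω x + P.α)
          + (P.β - P.α) ^ 2 * x / π - x * (P.A₁ - P.A₂)
          + π * (P.m ^ 2 * x / 2 + P.m * sin (2 * P.α) / 2 - P.Fπ - P.F₀)) ∧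
        P.Fπ = (ψp 0 - ψm 0) / (2 * π) ∧
        P.G₀ = (ψm π - ψp π) / (2 * π) ∧
        P.F₀ = -(ψp 0 + ψm 0) / (2 * π) + P.α * (P.β - P.α) / π + P.m * sin (2 * P.α) / 2 ∧
        P.Gπ = (ψm π + ψp π) / (2 * π) - P.β * (P.β - P.α) / π - P.m * sin (2 * P.β) / 2) ∧
    -- uniqueness: a second problem for which the elements of `X` are also nodal points
    (∀ Q : DiracProblem, Q.α ∈ Ioo (-(π / 2)) (π / 2) → Q.β ∈ Ioo (-(π / 2)) (π / 2) →
      Q.ω π = 0 → X ⊆ Q.nodalPoints →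
      Q.α = P.α ∧ Q.β = P.β ∧ EqOn Q.V P.V (Icc 0 π) ∧
      (NodalDense (evenPart X) → NodalDense (oddPart X) →
        Q.Fπ = P.Fπ ∧ Q.G₀ = P.G₀ ∧ (Q.m = P.m → Q.F₀ = P.F₀ ∧ Q.Gπ = P.Gπ))) := by
  refine ⟨⟨fun x => P.ω x + (P.β - P.α) * x / π + P.α,
    DiracProblem.isLimitFunction_nodalQ₁ hα hβ hω hX hdense, fun _ _ => rfl, ?_, ?_,
    fun x hx => ⟨(P.hasDerivAt_firstLimit hx).differentiableAt, ?_⟩⟩, fun he ho => ?_,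
    fun Q hα' hβ' hω' hX' => ?_⟩
  · simp [DiracProblem.ω]
  · simp only [hω, mul_div_cancel_right₀ _ pi_pos.ne']
    ring
  · rw [(P.hasDerivAt_firstLimit hx).deriv]
    ring
  · refine ⟨P.secondLimit 1, P.secondLimit (-1),
      DiracProblem.isLimitFunction_evenPart hα hβ hω hX he,
      DiracProblem.isLimitFunction_oddPart hα hβ hω hX ho, fun x _ => ?_, fun x _ => ?_,
      P.Fπ_eq, DiracProblem.G₀_eq hω, P.F₀_eq, DiracProblem.Gπ_eq hω⟩ <;>
    · rw [DiracProblem.secondLimit]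
      ring
  · obtain ⟨hae, hbe, hωe, hVe⟩ := DiracProblem.eq_of_common_nodalPoints hα hβ hω hX
      hα' hβ' hω' hX' hdense
    refine ⟨hae, hbe, hVe, fun he ho => ?_⟩
    -- The second quantity involves `ω`, `α` and `β`, already known to be common to both problems,
    -- so it is the same function on `X`.
    have hq : EqOn (nodalQ₂ Q.ω Q.α Q.β) (nodalQ₂ P.ω P.α P.β) X := by
      intro p hp
      obtain ⟨_, _, _, -, -, -, ⟨hmem, -⟩, -⟩ := hX hp
      simp only [nodalQ₂, hae, hbe, hωe (Ioo_subset_Icc_self hmem)]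
    have hp := (DiracProblem.isLimitFunction_evenPart hα' hβ' hω' hX' he).eqOn
      (DiracProblem.isLimitFunction_evenPart hα hβ hω hX he) fun p h => hq h.1
    have hm := (DiracProblem.isLimitFunction_oddPart hα' hβ' hω' hX' ho).eqOn
      (DiracProblem.isLimitFunction_oddPart hα hβ hω hX ho) fun p h => hq h.1
    have h0 : (0 : ℝ) ∈ Icc 0 π := ⟨le_rfl, pi_pos.le⟩
    have hπ : π ∈ Icc (0 : ℝ) π := ⟨pi_pos.le, le_rfl⟩
    refine ⟨?_, ?_, fun hme => ⟨?_, ?_⟩⟩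
    · rw [P.Fπ_eq, Q.Fπ_eq, hp h0, hm h0]
    · rw [DiracProblem.G₀_eq hω, DiracProblem.G₀_eq hω', hp hπ, hm hπ]
    · rw [P.F₀_eq, Q.F₀_eq, hp h0, hm h0, hae, hbe, hme]
    · rw [DiracProblem.Gπ_eq hω, DiracProblem.Gπ_eq hω', hp hπ, hm hπ, hae, hbe, hme]
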